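/- Let $q=e^{2\pi i/3}$ and let $A$ be the quantum plane, i.e. the unital $\mathbb C$-algebra generated by $x,y$ with $xy=q\,yx$. Let $A^1$ be the $A$-bimodule of one-forms that is free as a right $A$-module on $\theta^1=\xi$, $\theta^2=\eta$, with $$x\xi=q^2\xi x,\quad x\eta=q\,\eta x+(q^2-1)\xi y,\quad y\xi=q\,\xi y,\quad y\eta=q^2\eta y,$$ and let $d:A\to A^1$ be the derivation with $dx=\xi$, $dy=\eta$. Let $\sigma$ be the bimodule automorphism of $A^1\otimes_AA^1$ with $$\sigma(\xi\otimes\xi)=q^{-2}\xi\otimes\xi,\quad \sigma(\xi\otimes\eta)=q^{-1}\eta\otimes\xi,\quad \sigma(\eta\otimes\xi)=q^{-1}\xi\otimes\eta-(1-q^{-2})\eta\otimes\xi,\quad \sigma(\eta\otimes\eta)=q^{-2}\eta\otimes\eta.$$ A left connection is a $\mathbb C$-linear map $\nabla^L:A^1\to A^1\otimes_AA^1$ with $\nabla^L(a\zeta)=da\otimes\zeta+a\nabla^L\zeta$, and a right connection is a $\mathbb C$-linear map $\nabla^R:A^1\to A^1\otimes_AA^1$ with $\nabla^R(\zeta a)=(\nabla^R\zeta)a+\zeta\otimes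 da$, for all $a\in A$, $\zeta\in A^1$. Their Christoffel symbols are the elements $\Gamma^i_{jk},\widetilde\Gamma^i_{jk}\in A$ with $\nabla^L\theta^i=\sum_{j,k}\theta^j\otimes\theta^k\,\Gamma^i_{jk}$ and $\nabla^R\theta^i=\sum_{j,k}\theta^j\otimes\theta^k\,\widetilde\Gamma^i_{jk}$. The pair $(\nabla^L,\nabla^R)$ is called $\sigma$-compatible if $\nabla^L\zeta=\sigma(\nabla^R\zeta)$ for every $\zeta$ in the centre $Z(A^1)=\{\zeta\in A^1: a\zeta=\zeta a\ \ \forall a\in A\}$. Let $\nabla^L$ be a left connection with Christoffel symbols $\Gamma^i_{jk}$. Expressions with $x^{-1},y^{-1}$ are read in the algebra obtained from $A$ by adjoining inverses of $x$ and $y$. (1) There is a right connection $\nabla^R$ such that $(\nabla^L,\nabla^R)$ is $\sigma$-compatible if and only if $$\Gamma^1_{12}\in xA,\quad \Gamma^1_{21}\in xA,\quad \Gamma^1_{22}\in x^2A,\quad \Gamma^2_{22}\in xA,\quad (q-1)\Gamma^2_{12}+(1-q^2)\Gamma^2_{21}+3q^2yx^{-1}\Gamma^2_{22}\in xA .$$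 (2) If these conditions hold, then this $\nabla^R$ is unique. (3) A right connection $\nabla^R$ with Christoffel symbols $\widetilde\Gamma^i_{jk}$ is $\sigma$-compatible with $\nabla^L$ if and only if $$\begin{aligned} \widetilde\Gamma^1_{11}&=q^2xy\Gamma^1_{11}y^{-1}x^{-1}+(1-q)y^2\Gamma^1_{12}y^{-1}x^{-1}+(q^2-1)y^2\Gamma^1_{21}y^{-1}x^{-1},\\ \widetilde\Gamma^1_{12}&=(q^2-1)xy\Gamma^1_{12}y^{-1}x^{-1}+q\,xy\Gamma^1_{21}y^{-1}x^{-1}+(q-q^2)y^2\Gamma^1_{22}y^{-1}x^{-1},\\ \widetilde\Gamma^1_{21}&=q\,xy\Gamma^1_{12}y^{-1}x^{-1}+(1-q)y^2\Gamma^1_{22}y^{-1}x^{-1},\\ \widetilde\Gamma^1_{22}&=q^2xy\Gamma^1_{22}y^{-1}x^{-1},\\ \widetilde\Gamma^2_{11}&=xy\Gamma^1_{11}x^{-2}-x\Gamma^1_{11}yx^{-2}+(q-1)y\Gamma^1_{12}yx^{-2}+(q-q^2)y^2\Gamma^1_{12}x^{-2}+(1-q^2)y\Gamma^1_{21}yx^{-2}\\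 &\quad+(1-q)y^2\Gamma^1_{21}x^{-2}+q^2x^2y^2\Gamma^2_{11}y^{-2}x^{-2}+(q-1)x\Gamma^2_{12}yx^{-2}+(1-q^2)x\Gamma^2_{21}yx^{-2}+3y\Gamma^2_{22}yx^{-2},\\ \widetilde\Gamma^2_{12}&=(1-q^2)x\Gamma^1_{12}yx^{-2}+(q^2-1)y^2\Gamma^1_{22}x^{-2}+(1-q)xy\Gamma^1_{12}x^{-2}+q^2xy\Gamma^1_{21}x^{-2}-q\,x\Gamma^1_{21}yx^{-2}\\ &\quad+(q-1)y\Gamma^1_{22}yx^{-2}+(q^2-1)x^2y^2\Gamma^2_{12}y^{-2}x^{-2}+q\,x^2y^2\Gamma^2_{21}y^{-2}x^{-2}+(q^2-q)x\Gamma^2_{22}yx^{-2},\\ \widetilde\Gamma^2_{21}&=q^2xy\Gamma^1_{12}x^{-2}-q\,x\Gamma^1_{12}yx^{-2}+(1-q^2)y\Gamma^1_{22}yx^{-2}+(q-q^2)y^2\Gamma^1_{22}x^{-2}+q\,x^2y^2\Gamma^2_{12}y^{-2}x^{-2}+(q-1)x\Gamma^2_{22}yx^{-2},\\ \widetilde\Gamma^2_{22}&=xy\Gamma^1_{22}x^{-2}-q\,x\Gamma^1_{22}yx^{-2}+q^2x^2y^2\Gamma^2_{22}y^{-2}x^{-2}.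 \end{aligned}$$ -/

import Mathlib

open scoped TensorProduct RightActions

set_option linter.unusedSectionVars false

noncomputable section

/-! ## Bimodules, tensor products over a noncommutative algebra, connections -/

section General

variable (A : Type*) [Ring A] [Algebra ℂ A]

/-- The subspace of `M ⊗_ℂ N` spanned by all `m a ⊗ n - m ⊗ a n`. -/
def balancedRelations (M N : Type*) [AddCommGroup M] [Module ℂ M] [Module Aᵐᵒᵖ M]
    [AddCommGroup N] [Module ℂ N] [Module A N] : Submodule ℂ (M ⊗[ℂ] N) :=
  Submodule.span ℂ {t | ∃ (m : M) (a : A) (n : N), t = (m <• a) ⊗ₜ[ℂ] n - m ⊗ₜ[ℂ] (a • n)}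

/-- The tensor product `M ⊗_A N` of a right `A`-module `M` and a left `A`-module `N` over a
(noncommutative) `ℂ`-algebra `A`. -/
def BalancedTensor (M N : Type*) [AddCommGroup M] [Module ℂ M] [Module Aᵐᵒᵖ M]
    [AddCommGroup N] [Module ℂ N] [Module A N] : Type _ :=
  (M ⊗[ℂ] N) ⧸ balancedRelations A M N

namespace BalancedTensor

section Basic

variable (M N : Type*) [AddCommGroup M] [Module ℂ M] [Module Aᵐᵒᵖ M]
    [AddCommGroup N] [Module ℂ N] [Module A N]

instance instAddCommGroup : AddCommGroup (BalancedTensor A M N) :=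
  inferInstanceAs (AddCommGroup ((M ⊗[ℂ] N) ⧸ balancedRelations A M N))

instance instModuleComplex : Module ℂ (BalancedTensor A M N) :=
  inferInstanceAs (Module ℂ ((M ⊗[ℂ] N) ⧸ balancedRelations A M N))

/-- The projection `M ⊗_ℂ N → M ⊗_A N`. -/
def proj : (M ⊗[ℂ] N) →ₗ[ℂ] BalancedTensor A M N := (balancedRelations A M N).mkQ

variable {M N}

/-- The class `m ⊗_A n`. -/
def tmul (m : M) (n : N) : BalancedTensor A M N := proj A M N (m ⊗ₜ[ℂ] n)

variable {A}

theorem smul_tmul (m : M) (a : A) (n : N) : tmul A (m <• a) n = tmul A m (a • n) := by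
  unfold tmul
  rw [← sub_eq_zero, ← map_sub]
  exact (Submodule.Quotient.mk_eq_zero _).2 (Submodule.subset_span ⟨m, a, n, rfl⟩)

theorem add_tmul (m m' : M) (n : N) : tmul A (m + m') n = tmul A m n + tmul A m' n := by
  simp [tmul, TensorProduct.add_tmul]

theorem tmul_add (m : M) (n n' : N) : tmul A m (n + n') = tmul A m n + tmul A m n' := by
  simp [tmul, TensorProduct.tmul_add]

@[elab_as_elim]
theorem induction_on {P : BalancedTensor A M N → Prop} (t : BalancedTensor A M N)
    (h0 : P 0) (ht : ∀ m n, P (tmul A m n)) (ha : ∀ s t, P s → P t → P (s + t)) : P t := by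
  obtain ⟨t, rfl⟩ := (balancedRelations A M N).mkQ_surjective t
  induction t using TensorProduct.induction_on with
  | zero => rw [map_zero]; exact h0
  | tmul m n => exact ht m n
  | add s t hs ht => rw [map_add]; exact ha _ _ hs ht

/-- A `ℂ`-bilinear map that is `A`-balanced factors through `M ⊗_A N`. -/
def lift {P : Type*} [AddCommGroup P] [Module ℂ P] (f : M →ₗ[ℂ] N →ₗ[ℂ] P)
    (hf : ∀ (m : M) (a : A) (n : N), f (m <• a) n = f m (a • n)) :
    BalancedTensor A M N →ₗ[ℂ] P :=
  (balancedRelations A M N).liftQ (TensorProduct.lift f) <| by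
    refine Submodule.span_le.2 ?_
    rintro _ ⟨m, a, n, rfl⟩
    simp [hf]

@[simp]
theorem lift_tmul {P : Type*} [AddCommGroup P] [Module ℂ P] (f : M →ₗ[ℂ] N →ₗ[ℂ] P)
    (hf : ∀ (m : M) (a : A) (n : N), f (m <• a) n = f m (a • n)) (m : M) (n : N) :
    lift f hf (tmul A m n) = f m n := by
  change TensorProduct.lift f (m ⊗ₜ[ℂ] n) = f m n
  simp

end Basic

section Actions

variable {A}
variable {M N : Type*}
    [AddCommGroup M] [Module ℂ M] [Module A M] [Module Aᵐᵒᵖ M]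
    [SMulCommClass A Aᵐᵒᵖ M] [IsScalarTower ℂ A M] [IsScalarTower ℂ Aᵐᵒᵖ M]
    [AddCommGroup N] [Module ℂ N] [Module A N] [Module Aᵐᵒᵖ N]
    [SMulCommClass A Aᵐᵒᵖ N] [IsScalarTower ℂ A N] [IsScalarTower ℂ Aᵐᵒᵖ N]

/-- `m ⊗ n ↦ a m ⊗ n`. -/
def leftMul (a : A) : BalancedTensor A M N →ₗ[ℂ] BalancedTensor A M N :=
  lift ((TensorProduct.mk ℂ M N).compr₂ (proj A M N) ∘ₗ
      (Algebra.lsmul ℂ ℂ M a : M →ₗ[ℂ] M)) <| by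
    intro m b n
    change tmul A (a • (m <• b)) n = tmul A (a • m) (b • n)
    rw [smul_comm, smul_tmul]

/-- `m ⊗ n ↦ m ⊗ n a`. -/
def rightMul (a : Aᵐᵒᵖ) : BalancedTensor A M N →ₗ[ℂ] BalancedTensor A M N :=
  lift ((TensorProduct.mk ℂ M N).compr₂ (proj A M N) |>.compl₂
      (Algebra.lsmul ℂ ℂ N a : N →ₗ[ℂ] N)) <| by
    intro m b n
    change tmul A (m <• b) (a • n) = tmul A m (a • (b • n))
    rw [smul_tmul, smul_comm]

theorem leftMul_tmul (a : A) (m : M) (n : N) :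
    leftMul a (tmul A m n) = tmul A (a • m) n := lift_tmul _ _ _ _

theorem rightMul_tmul (a : Aᵐᵒᵖ) (m : M) (n : N) :
    rightMul a (tmul A m n) = tmul A m (a • n) := lift_tmul _ _ _ _

instance instModuleLeft : Module A (BalancedTensor A M N) where
  smul a t := leftMul a t
  one_smul t := by
    change leftMul 1 t = t
    induction t using induction_on with
    | h0 => simp
    | ht m n => simp [leftMul_tmul]
    | ha s t hs ht => rw [map_add, hs, ht]
  mul_smul a b t := by
    change leftMul (a * b) t = leftMul a (leftMul b t)
    induction t using induction_on with
    | h0 => simp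
    | ht m n => simp [leftMul_tmul, mul_smul]
    | ha s t hs ht => simp only [map_add, hs, ht]
  smul_zero a := map_zero (leftMul a)
  smul_add a := map_add (leftMul a)
  add_smul a b t := by
    change leftMul (a + b) t = leftMul a t + leftMul b t
    induction t using induction_on with
    | h0 => simp
    | ht m n => simp [leftMul_tmul, add_smul, add_tmul]
    | ha s t hs ht => simp only [map_add, hs, ht]; abel
  zero_smul t := by
    change leftMul 0 t = 0
    induction t using induction_on with
    | h0 => simp
    | ht m n => rw [leftMul_tmul, zero_smul, tmul, TensorProduct.zero_tmul, map_zero]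
    | ha s t hs ht => simp only [map_add, hs, ht, add_zero]

instance instModuleRight : Module Aᵐᵒᵖ (BalancedTensor A M N) where
  smul a t := rightMul a t
  one_smul t := by
    change rightMul 1 t = t
    induction t using induction_on with
    | h0 => simp
    | ht m n => simp [rightMul_tmul]
    | ha s t hs ht => rw [map_add, hs, ht]
  mul_smul a b t := by
    change rightMul (a * b) t = rightMul a (rightMul b t)
    induction t using induction_on with
    | h0 => simp
    | ht m n => simp [rightMul_tmul, mul_smul]
    | ha s t hs ht => simp only [map_add, hs, ht]
  smul_zero a := map_zero (rightMul a)
  smul_add a := map_add (rightMul a)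
  add_smul a b t := by
    change rightMul (a + b) t = rightMul a t + rightMul b t
    induction t using induction_on with
    | h0 => simp
    | ht m n => simp [rightMul_tmul, add_smul, tmul_add]
    | ha s t hs ht => simp only [map_add, hs, ht]; abel
  zero_smul t := by
    change rightMul 0 t = 0
    induction t using induction_on with
    | h0 => simp
    | ht m n => rw [rightMul_tmul, zero_smul, tmul, TensorProduct.tmul_zero, map_zero]
    | ha s t hs ht => simp only [map_add, hs, ht, add_zero]

theorem left_smul_tmul (a : A) (m : M) (n : N) : a • tmul A m n = tmul A (a • m) n :=
  leftMul_tmul a m n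

theorem right_smul_tmul (a : A) (m : M) (n : N) : tmul A m n <• a = tmul A m (n <• a) :=
  rightMul_tmul _ m n

theorem complex_smul_tmul (c : ℂ) (m : M) (n : N) : c • tmul A m n = tmul A (c • m) n := by
  rw [tmul, ← map_smul, TensorProduct.smul_tmul']; rfl

theorem complex_smul_tmul_right (c : ℂ) (m : M) (n : N) :
    c • tmul A m n = tmul A m (c • n) := by
  rw [tmul, ← map_smul, ← TensorProduct.tmul_smul]; rfl

instance instSMulCommClass : SMulCommClass A Aᵐᵒᵖ (BalancedTensor A M N) where
  smul_comm a b t := by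
    obtain ⟨b, rfl⟩ := MulOpposite.op_surjective b
    induction t using induction_on with
    | h0 => simp
    | ht m n => simp only [left_smul_tmul, right_smul_tmul]
    | ha s t hs ht => simp only [smul_add, hs, ht]

instance instIsScalarTowerLeft : IsScalarTower ℂ A (BalancedTensor A M N) where
  smul_assoc c a t := by
    induction t using induction_on with
    | h0 => simp
    | ht m n => simp only [left_smul_tmul, complex_smul_tmul, smul_assoc]
    | ha s t hs ht => simp only [smul_add, hs, ht]

instance instIsScalarTowerRight : IsScalarTower ℂ Aᵐᵒᵖ (BalancedTensor A M N) where
  smul_assoc c a t := by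
    obtain ⟨a, rfl⟩ := MulOpposite.op_surjective a
    induction t using induction_on with
    | h0 => simp
    | ht m n =>
      rw [← MulOpposite.op_smul, right_smul_tmul, right_smul_tmul, complex_smul_tmul_right,
        MulOpposite.op_smul, smul_assoc]
    | ha s t hs ht => simp only [smul_add, hs, ht]

end Actions

end BalancedTensor

section Connections

variable {A}
variable {Ω E : Type*}
    [AddCommGroup Ω] [Module ℂ Ω] [Module A Ω] [Module Aᵐᵒᵖ Ω]
    [SMulCommClass A Aᵐᵒᵖ Ω] [IsScalarTower ℂ A Ω] [IsScalarTower ℂ Aᵐᵒᵖ Ω]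
    [AddCommGroup E] [Module ℂ E] [Module A E] [Module Aᵐᵒᵖ E]
    [SMulCommClass A Aᵐᵒᵖ E] [IsScalarTower ℂ A E] [IsScalarTower ℂ Aᵐᵒᵖ E]

/-- Left connection on the bimodule `E`, for the first order calculus `d : A → Ω`:
`∇(a ζ) = da ⊗ ζ + a ∇ζ`. -/
def IsLeftConnection (d : A →ₗ[ℂ] Ω) (nabla : E →ₗ[ℂ] BalancedTensor A Ω E) : Prop :=
  ∀ (a : A) (ζ : E), nabla (a • ζ) = BalancedTensor.tmul A (d a) ζ + a • nabla ζ

/-- Right connection on the bimodule `E`, for the first order calculus `d : A → Ω`: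
`∇(ζ a) = (∇ζ) a + ζ ⊗ da`. -/
def IsRightConnection (d : A →ₗ[ℂ] Ω) (nabla : E →ₗ[ℂ] BalancedTensor A E Ω) : Prop :=
  ∀ (ζ : E) (a : A), nabla (ζ <• a) = nabla ζ <• a + BalancedTensor.tmul A ζ (d a)

variable (A E) in
/-- The centre `Z(E) = {ζ | a ζ = ζ a for all a}` of a bimodule. -/
def bimoduleCentre : Set E := {ζ | ∀ a : A, a • ζ = ζ <• a}

/-- `∇^L ζ = σ (∇^R ζ)` for all central `ζ`. -/
def SigmaCompatible (σ : BalancedTensor A E Ω →ₗ[ℂ] BalancedTensor A Ω E)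
    (nablaL : E →ₗ[ℂ] BalancedTensor A Ω E) (nablaR : E →ₗ[ℂ] BalancedTensor A E Ω) : Prop :=
  ∀ ζ ∈ bimoduleCentre A E, nablaL ζ = σ (nablaR ζ)

end Connections

end General

/-! ## The quantum plane at the cubic root of unity -/

namespace QuantumPlane

/-- `q = e^{2πi/3}`. -/
def q : ℂ := Complex.exp (2 * Real.pi * Complex.I / 3)

theorem q_pow_three : q ^ 3 = 1 := by
  rw [q, ← Complex.exp_nat_mul, ← Complex.exp_two_pi_mul_I]
  congr 1
  push_cast
  ring

theorem q_ne_zero : q ≠ 0 := Complex.exp_ne_zero _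

/-- The relation `x y = q y x`, where `x`, `y` are the free generators `0`, `1`. -/
inductive Rel : FreeAlgebra ℂ (Fin 2) → FreeAlgebra ℂ (Fin 2) → Prop
  | comm : Rel (FreeAlgebra.ι ℂ 0 * FreeAlgebra.ι ℂ 1)
      (q • (FreeAlgebra.ι ℂ 1 * FreeAlgebra.ι ℂ 0))

/-- The quantum plane: the unital `ℂ`-algebra generated by `x`, `y` subject to `x y = q y x`. -/
def Plane : Type := RingQuot Rel

instance : Ring Plane := inferInstanceAs (Ring (RingQuot Rel))

instance : Algebra ℂ Plane := inferInstanceAs (Algebra ℂ (RingQuot Rel))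

/-- The generators `x = gen 0` and `y = gen 1`. -/
def gen (i : Fin 2) : Plane := RingQuot.mkAlgHom ℂ Rel (FreeAlgebra.ι ℂ i)

def x : Plane := gen 0

def y : Plane := gen 1

theorem x_mul_y : x * y = q • (y * x) := by
  have h := RingQuot.mkAlgHom_rel ℂ Rel.comm
  rw [map_mul, map_smul, map_mul] at h
  exact h

/-- The algebra homomorphism out of the quantum plane with `x ↦ X`, `y ↦ Y`,
if `X Y = q Y X`. -/
def liftPlane {B : Type*} [Ring B] [Algebra ℂ B] (X Y : B) (h : X * Y = q • (Y * X)) :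
    Plane →ₐ[ℂ] B :=
  RingQuot.liftAlgHom ℂ ⟨FreeAlgebra.lift ℂ ![X, Y], by
    rintro _ _ ⟨⟩
    simpa using h⟩

@[simp]
theorem liftPlane_x {B : Type*} [Ring B] [Algebra ℂ B] (X Y : B) (h : X * Y = q • (Y * X)) :
    liftPlane X Y h x = X := by
  change RingQuot.liftAlgHom ℂ _ (RingQuot.mkAlgHom ℂ Rel _) = _
  simp

@[simp]
theorem liftPlane_y {B : Type*} [Ring B] [Algebra ℂ B] (X Y : B) (h : X * Y = q • (Y * X)) :
    liftPlane X Y h y = Y := by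
  change RingQuot.liftAlgHom ℂ _ (RingQuot.mkAlgHom ℂ Rel _) = _
  simp

@[elab_as_elim]
theorem plane_induction {P : Plane → Prop} (a : Plane) (hc : ∀ c : ℂ, P (algebraMap ℂ Plane c))
    (hx : P x) (hy : P y) (hadd : ∀ a b, P a → P b → P (a + b))
    (hmul : ∀ a b, P a → P b → P (a * b)) : P a := by
  obtain ⟨a, rfl⟩ := RingQuot.mkAlgHom_surjective ℂ Rel a
  induction a using FreeAlgebra.induction with
  | grade0 c => rw [AlgHom.commutes]; exact hc c
  | grade1 i => fin_cases i; exacts [hx, hy]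
  | mul a b ha hb => rw [map_mul]; exact hmul _ _ ha hb
  | add a b ha hb => rw [map_add]; exact hadd _ _ ha hb

/-! ### One-forms -/

theorem commutation_relation :
    (!![q ^ 2 • x, (q ^ 2 - 1) • y; 0, q • x] * !![q • y, 0; 0, q ^ 2 • y] :
        Matrix (Fin 2) (Fin 2) Plane) =
      q • (!![q • y, 0; 0, q ^ 2 • y] * !![q ^ 2 • x, (q ^ 2 - 1) • y; 0, q • x]) := by
  ext i j
  fin_cases i <;> fin_cases j <;>
    simp [Matrix.mul_apply, smul_smul, x_mul_y] <;> ring_nf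

/-- The matrices of left multiplication on one-forms: `a θ^j = ∑ k, θ^k (commutation a) k j`,
where `θ^1 = ξ = dx`, `θ^2 = η = dy`. It encodes
`x ξ = q² ξ x`, `x η = q η x + (q² - 1) ξ y`, `y ξ = q ξ y`, `y η = q² η y`. -/
def commutation : Plane →ₐ[ℂ] Matrix (Fin 2) (Fin 2) Plane :=
  liftPlane !![q ^ 2 • x, (q ^ 2 - 1) • y; 0, q • x] !![q • y, 0; 0, q ^ 2 • y]
    commutation_relation

/-- The bimodule `A¹` of one-forms: the free right module on `ξ`, `η`, where `ω` stands for
`ξ (ω 0) + η (ω 1)`, with the left multiplication given by the commutation relations. -/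
def OneForm : Type := Fin 2 → Plane

namespace OneForm

instance : AddCommGroup OneForm := inferInstanceAs (AddCommGroup (Fin 2 → Plane))

instance : Module ℂ OneForm := inferInstanceAs (Module ℂ (Fin 2 → Plane))

instance : Module Planeᵐᵒᵖ OneForm := inferInstanceAs (Module Planeᵐᵒᵖ (Fin 2 → Plane))

instance : Module Plane OneForm where
  smul a ω := (commutation a).mulVec ω
  one_smul ω :=
    (congrArg (fun m => Matrix.mulVec m ω) (map_one commutation)).trans (Matrix.one_mulVec _)
  mul_smul a b ω :=
    (congrArg (fun m => Matrix.mulVec m ω) (map_mul commutation a b)).trans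
      (Matrix.mulVec_mulVec _ _ _).symm
  smul_zero _ := Matrix.mulVec_zero _
  smul_add _ := Matrix.mulVec_add _
  add_smul a b ω :=
    (congrArg (fun m => Matrix.mulVec m ω) (map_add commutation a b)).trans
      (Matrix.add_mulVec _ _ _)
  zero_smul ω :=
    (congrArg (fun m => Matrix.mulVec m ω) (map_zero commutation)).trans (Matrix.zero_mulVec _)

theorem left_smul_apply (a : Plane) (ω : OneForm) (i : Fin 2) :
    (a • ω) i = commutation a i 0 * ω 0 + commutation a i 1 * ω 1 := by
  change (commutation a).mulVec ω i = _
  simp [Matrix.mulVec, dotProduct, Fin.sum_univ_two]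

theorem right_smul_apply (ω : OneForm) (a : Plane) (i : Fin 2) : (ω <• a) i = ω i * a := rfl

theorem complex_smul_apply (c : ℂ) (ω : OneForm) (i : Fin 2) : (c • ω) i = c • ω i := rfl

theorem zero_apply (i : Fin 2) : (0 : OneForm) i = 0 := rfl

theorem add_apply (ω ρ : OneForm) (i : Fin 2) : (ω + ρ) i = ω i + ρ i := rfl

instance : SMulCommClass Plane Planeᵐᵒᵖ OneForm where
  smul_comm a b ω := by
    funext i
    obtain ⟨b, rfl⟩ := MulOpposite.op_surjective b
    simp only [left_smul_apply, right_smul_apply]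
    rw [add_mul, mul_assoc, mul_assoc]

instance : IsScalarTower ℂ Plane OneForm where
  smul_assoc c a ω := by
    funext i
    simp [left_smul_apply, complex_smul_apply]

instance : IsScalarTower ℂ Planeᵐᵒᵖ OneForm :=
  inferInstanceAs (IsScalarTower ℂ Planeᵐᵒᵖ (Fin 2 → Plane))

end OneForm

/-- The one-forms `θ^1 = ξ` (index `0`) and `θ^2 = η` (index `1`). -/
def θ (i : Fin 2) : OneForm := fun j => if j = i then 1 else 0

theorem θ_apply (i j : Fin 2) : θ i j = if j = i then 1 else 0 := rfl

theorem eq_sum_θ (ω : OneForm) : ω = θ 0 <• ω 0 + θ 1 <• ω 1 := by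
  funext i
  fin_cases i <;> simp [OneForm.add_apply, OneForm.right_smul_apply, θ_apply]

theorem x_smul_ξ : x • θ 0 = q ^ 2 • (θ 0 <• x) := by
  funext i
  fin_cases i <;> simp [OneForm.left_smul_apply, OneForm.right_smul_apply,
    OneForm.complex_smul_apply, θ_apply, commutation]

theorem x_smul_η : x • θ 1 = q • (θ 1 <• x) + (q ^ 2 - 1) • (θ 0 <• y) := by
  funext i
  fin_cases i <;> simp [OneForm.left_smul_apply, OneForm.right_smul_apply, OneForm.add_apply,
    OneForm.complex_smul_apply, θ_apply, commutation]

theorem y_smul_ξ : y • θ 0 = q • (θ 0 <• y) := by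
  funext i
  fin_cases i <;> simp [OneForm.left_smul_apply, OneForm.right_smul_apply,
    OneForm.complex_smul_apply, θ_apply, commutation]

theorem y_smul_η : y • θ 1 = q ^ 2 • (θ 1 <• y) := by
  funext i
  fin_cases i <;> simp [OneForm.left_smul_apply, OneForm.right_smul_apply,
    OneForm.complex_smul_apply, θ_apply, commutation]

/-! ### The exterior derivative -/

theorem derivation_relation :
    ((TrivSqZeroExt.inl x + TrivSqZeroExt.inr (θ 0)) *
        (TrivSqZeroExt.inl y + TrivSqZeroExt.inr (θ 1)) : TrivSqZeroExt Plane OneForm) =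
      q • ((TrivSqZeroExt.inl y + TrivSqZeroExt.inr (θ 1)) *
        (TrivSqZeroExt.inl x + TrivSqZeroExt.inr (θ 0))) := by
  ext
  · simp [x_mul_y]
  · simp only [TrivSqZeroExt.snd_mul, TrivSqZeroExt.snd_smul, TrivSqZeroExt.fst_add,
      TrivSqZeroExt.snd_add, TrivSqZeroExt.fst_inl, TrivSqZeroExt.fst_inr,
      TrivSqZeroExt.snd_inl, TrivSqZeroExt.snd_inr, add_zero, zero_add]
    rw [x_smul_η, y_smul_ξ]
    generalize θ 0 <• y = u
    generalize θ 1 <• x = v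
    module

/-- The algebra homomorphism `a ↦ (a, da)` into the square-zero extension `A ⊕ A¹`, with
`x ↦ (x, ξ)` and `y ↦ (y, η)`. -/
def graphOfD : Plane →ₐ[ℂ] TrivSqZeroExt Plane OneForm :=
  liftPlane (TrivSqZeroExt.inl x + TrivSqZeroExt.inr (θ 0))
    (TrivSqZeroExt.inl y + TrivSqZeroExt.inr (θ 1)) derivation_relation

/-- The exterior derivative `d : A → A¹`, the derivation with `dx = ξ`, `dy = η`. -/
def d : Plane →ₗ[ℂ] OneForm where
  toFun a := (graphOfD a).snd
  map_add' a b := by simp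
  map_smul' c a := by simp

theorem d_x : d x = θ 0 := by simp [d, graphOfD]

theorem d_y : d y = θ 1 := by simp [d, graphOfD]

theorem graphOfD_fst (a : Plane) : (graphOfD a).fst = a := by
  induction a using plane_induction with
  | hc c => rw [AlgHom.commutes]; rfl
  | hx => simp [graphOfD]
  | hy => simp [graphOfD]
  | hadd a b ha hb => simp [ha, hb]
  | hmul a b ha hb => simp [ha, hb]

theorem d_mul (a b : Plane) : d (a * b) = a • d b + d a <• b := by
  simp [d, graphOfD_fst]

/-! ### `A¹ ⊗_A A¹` and the flip `σ` -/

/-- The bimodule `A¹ ⊗_A A¹`. -/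
abbrev TwoTensor : Type := BalancedTensor Plane OneForm OneForm

/-- `θ^j ⊗_A θ^k`. -/
def θθ (j k : Fin 2) : TwoTensor := BalancedTensor.tmul Plane (θ j) (θ k)

/-- The right `A`-linear map out of `A¹ ⊗_A A¹` with `θ^j ⊗ θ^k ↦ b j k`. -/
def rightLift {P : Type*} [AddCommGroup P] [Module ℂ P] [Module Planeᵐᵒᵖ P]
    [IsScalarTower ℂ Planeᵐᵒᵖ P] (b : Fin 2 → Fin 2 → P) :
    TwoTensor →ₗ[ℂ] P :=
  BalancedTensor.lift
    (LinearMap.mk₂ ℂ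
      (fun ω ρ : OneForm => ∑ j : Fin 2, ∑ k : Fin 2, b j k <• (ω j • ρ) k)
      (by
        intro ω ω' ρ
        simp [OneForm.add_apply, add_smul]
        abel)
      (by
        intro c ω ρ
        simp [OneForm.complex_smul_apply, smul_assoc])
      (by
        intro ω ρ ρ'
        simp [OneForm.add_apply, add_smul]
        abel)
      (by
        intro c ω ρ
        simp only [smul_comm _ c ρ, OneForm.complex_smul_apply, MulOpposite.op_smul,
          Finset.smul_sum, smul_assoc]))
    (by
      intro ω a ρ
      simp [OneForm.right_smul_apply, mul_smul])

theorem rightLift_θθ {P : Type*} [AddCommGroup P] [Module ℂ P] [Module Planeᵐᵒᵖ P]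
    [IsScalarTower ℂ Planeᵐᵒᵖ P] (b : Fin 2 → Fin 2 → P) (j k : Fin 2) :
    rightLift b (θθ j k) = b j k := by
  rw [rightLift, θθ, BalancedTensor.lift_tmul]
  fin_cases j <;> fin_cases k <;> simp [θ_apply, OneForm.zero_apply]

theorem rightLift_right_smul {P : Type*} [AddCommGroup P] [Module ℂ P] [Module Planeᵐᵒᵖ P]
    [IsScalarTower ℂ Planeᵐᵒᵖ P] (b : Fin 2 → Fin 2 → P) (t : TwoTensor) (a : Plane) :
    rightLift b (t <• a) = rightLift b t <• a := by
  induction t using BalancedTensor.induction_on with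
  | h0 => simp
  | ht m n =>
    rw [BalancedTensor.right_smul_tmul, rightLift, BalancedTensor.lift_tmul,
      BalancedTensor.lift_tmul]
    simp [smul_comm _ (MulOpposite.op a) n, OneForm.right_smul_apply, mul_smul]
  | ha s t hs ht => simp only [smul_add, map_add, hs, ht]

/-- Every element of `A¹ ⊗_A A¹` is uniquely of the form `∑ θ^j ⊗ θ^k c_{jk}`. -/
theorem existsUnique_coeff (t : TwoTensor) :
    ∃! c : Fin 2 → Fin 2 → Plane, t = ∑ j, ∑ k, θθ j k <• c j k := by
  let b : Fin 2 → Fin 2 → (Fin 2 → Fin 2 → Plane) :=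
    fun j k => Pi.single j (Pi.single k 1)
  refine ⟨rightLift b t, ?_, ?_⟩
  · change t = ∑ j, ∑ k, θθ j k <• rightLift b t j k
    induction t using BalancedTensor.induction_on with
    | h0 => simp
    | ht m n =>
      have hc : ∀ j k, rightLift b (BalancedTensor.tmul Plane m n) j k = (m j • n) k := by
        intro j k
        rw [rightLift, BalancedTensor.lift_tmul]
        fin_cases j <;> fin_cases k <;> simp [b]
      have hn : ∀ (a : Plane) (j : Fin 2), BalancedTensor.tmul Plane (θ j <• a) n =
          ∑ k, θθ j k <• (a • n) k := by
        intro a j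
        rw [BalancedTensor.smul_tmul, Fin.sum_univ_two]
        conv_lhs => rw [eq_sum_θ (a • n)]
        rw [BalancedTensor.tmul_add, ← BalancedTensor.right_smul_tmul,
          ← BalancedTensor.right_smul_tmul]
        rfl
      conv_lhs => rw [eq_sum_θ m]
      simp only [hc, BalancedTensor.add_tmul, hn, Fin.sum_univ_two]
    | ha s t hs ht =>
      refine (congrArg₂ (· + ·) hs ht).trans ?_
      simp only [map_add, Pi.add_apply, MulOpposite.op_add, add_smul, Finset.sum_add_distrib]
  · rintro c rfl
    simp only [map_sum, rightLift_right_smul, rightLift_θθ]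
    funext j k
    fin_cases j <;> fin_cases k <;> simp [b]

/-- The bimodule isomorphism `σ` of `A¹ ⊗_A A¹`:
`σ(ξ ⊗ ξ) = q⁻² ξ ⊗ ξ`, `σ(ξ ⊗ η) = q⁻¹ η ⊗ ξ`,
`σ(η ⊗ ξ) = q⁻¹ ξ ⊗ η - (1 - q⁻²) η ⊗ ξ`, `σ(η ⊗ η) = q⁻² η ⊗ η`. -/
def σ : TwoTensor →ₗ[ℂ] TwoTensor :=
  rightLift
    ![![(q ^ 2)⁻¹ • θθ 0 0, q⁻¹ • θθ 1 0],
      ![q⁻¹ • θθ 0 1 - (1 - (q ^ 2)⁻¹) • θθ 1 0, (q ^ 2)⁻¹ • θθ 1 1]]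

theorem σ_ξξ : σ (θθ 0 0) = (q ^ 2)⁻¹ • θθ 0 0 := rightLift_θθ _ 0 0

theorem σ_ξη : σ (θθ 0 1) = q⁻¹ • θθ 1 0 := rightLift_θθ _ 0 1

theorem σ_ηξ : σ (θθ 1 0) = q⁻¹ • θθ 0 1 - (1 - (q ^ 2)⁻¹) • θθ 1 0 := rightLift_θθ _ 1 0

theorem σ_ηη : σ (θθ 1 1) = (q ^ 2)⁻¹ • θθ 1 1 := rightLift_θθ _ 1 1

theorem σ_right_smul (t : TwoTensor) (a : Plane) : σ (t <• a) = σ t <• a :=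
  rightLift_right_smul _ t a

theorem x_smul_tmul_ξ (ω : OneForm) : x • BalancedTensor.tmul Plane (θ 0) ω =
    q ^ 2 • BalancedTensor.tmul Plane (θ 0) (x • ω) := by
  rw [BalancedTensor.left_smul_tmul, x_smul_ξ, ← BalancedTensor.complex_smul_tmul,
    BalancedTensor.smul_tmul]

theorem x_smul_tmul_η (ω : OneForm) : x • BalancedTensor.tmul Plane (θ 1) ω =
    q • BalancedTensor.tmul Plane (θ 1) (x • ω) +
      (q ^ 2 - 1) • BalancedTensor.tmul Plane (θ 0) (y • ω) := by
  rw [BalancedTensor.left_smul_tmul, x_smul_η, BalancedTensor.add_tmul,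
    ← BalancedTensor.complex_smul_tmul, ← BalancedTensor.complex_smul_tmul,
    BalancedTensor.smul_tmul, BalancedTensor.smul_tmul]

theorem y_smul_tmul_ξ (ω : OneForm) : y • BalancedTensor.tmul Plane (θ 0) ω =
    q • BalancedTensor.tmul Plane (θ 0) (y • ω) := by
  rw [BalancedTensor.left_smul_tmul, y_smul_ξ, ← BalancedTensor.complex_smul_tmul,
    BalancedTensor.smul_tmul]

theorem y_smul_tmul_η (ω : OneForm) : y • BalancedTensor.tmul Plane (θ 1) ω =
    q ^ 2 • BalancedTensor.tmul Plane (θ 1) (y • ω) := by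
  rw [BalancedTensor.left_smul_tmul, y_smul_η, ← BalancedTensor.complex_smul_tmul,
    BalancedTensor.smul_tmul]

theorem tmul_complex_right (c : ℂ) (ω : OneForm) (k : Fin 2) (a : Plane) :
    BalancedTensor.tmul Plane ω (c • (θ k <• a)) =
      c • (BalancedTensor.tmul Plane ω (θ k) <• a) := by
  rw [← BalancedTensor.complex_smul_tmul_right, BalancedTensor.right_smul_tmul]

theorem σ_left_smul_θθ_x (j k : Fin 2) : σ (x • θθ j k) = x • σ (θθ j k) := by
  have hq := q_ne_zero
  fin_cases j <;> fin_cases k <;>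
    simp only [Fin.zero_eta, Fin.mk_one, σ_ξξ, σ_ξη, σ_ηξ, σ_ηη, smul_sub,
      smul_comm x (_ : ℂ) (_ : TwoTensor)] <;>
    simp only [θθ, x_smul_tmul_ξ, x_smul_tmul_η, x_smul_ξ, x_smul_η, y_smul_ξ, y_smul_η,
      BalancedTensor.tmul_add, tmul_complex_right] <;>
    simp only [← θθ.eq_1, map_add, map_smul, σ_right_smul, σ_ξξ, σ_ξη, σ_ηξ, σ_ηη, smul_sub,
      smul_comm (MulOpposite.op x) (_ : ℂ) (_ : TwoTensor),
      smul_comm (MulOpposite.op y) (_ : ℂ) (_ : TwoTensor)] <;>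
    generalize θθ 0 0 <• x = a1 <;> generalize θθ 0 1 <• x = a2 <;>
    generalize θθ 1 0 <• x = a3 <;> generalize θθ 1 1 <• x = a4 <;>
    generalize θθ 0 0 <• y = b1 <;> generalize θθ 0 1 <• y = b2 <;>
    generalize θθ 1 0 <• y = b3 <;> generalize θθ 1 1 <• y = b4 <;>
    match_scalars <;> field_simp <;> ring

theorem σ_left_smul_θθ_y (j k : Fin 2) : σ (y • θθ j k) = y • σ (θθ j k) := by
  have hq := q_ne_zero
  fin_cases j <;> fin_cases k <;>
    simp only [Fin.zero_eta, Fin.mk_one, σ_ξξ, σ_ξη, σ_ηξ, σ_ηη, smul_sub,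
      smul_comm y (_ : ℂ) (_ : TwoTensor)] <;>
    simp only [θθ, y_smul_tmul_ξ, y_smul_tmul_η, y_smul_ξ, y_smul_η, tmul_complex_right] <;>
    simp only [← θθ.eq_1, map_smul, σ_right_smul, σ_ξξ, σ_ξη, σ_ηξ, σ_ηη, smul_sub,
      smul_comm (MulOpposite.op y) (_ : ℂ) (_ : TwoTensor)] <;>
    generalize θθ 0 0 <• y = b1 <;> generalize θθ 0 1 <• y = b2 <;>
    generalize θθ 1 0 <• y = b3 <;> generalize θθ 1 1 <• y = b4 <;>
    match_scalars <;> field_simp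

/-- `σ` is also left `A`-linear. -/
theorem σ_left_smul (a : Plane) (t : TwoTensor) : σ (a • t) = a • σ t := by
  have key : ∀ a : Plane, (∀ j k, σ (a • θθ j k) = a • σ (θθ j k)) →
      ∀ t : TwoTensor, σ (a • t) = a • σ t := by
    intro a h t
    obtain ⟨c, rfl, -⟩ := existsUnique_coeff t
    simp only [Finset.smul_sum, map_sum, smul_comm a (MulOpposite.op _) (_ : TwoTensor),
      σ_right_smul, h]
  induction a using plane_induction generalizing t with
  | hc c => rw [algebraMap_smul, algebraMap_smul, map_smul]
  | hx => exact key x σ_left_smul_θθ_x t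
  | hy => exact key y σ_left_smul_θθ_y t
  | hadd a b ha hb => rw [add_smul, add_smul, map_add, ha, hb]
  | hmul a b ha hb => rw [mul_smul, mul_smul, ha, hb]

theorem σ_bijective : Function.Bijective σ := by
  have hq := q_ne_zero
  let τ : TwoTensor →ₗ[ℂ] TwoTensor := rightLift
    ![![q ^ 2 • θθ 0 0, q • θθ 1 0 + (q ^ 2 - 1) • θθ 0 1], ![q • θθ 0 1, q ^ 2 • θθ 1 1]]
  have h00 : τ (θθ 0 0) = q ^ 2 • θθ 0 0 := rightLift_θθ _ 0 0
  have h01 : τ (θθ 0 1) = q • θθ 1 0 + (q ^ 2 - 1) • θθ 0 1 := rightLift_θθ _ 0 1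
  have h10 : τ (θθ 1 0) = q • θθ 0 1 := rightLift_θθ _ 1 0
  have h11 : τ (θθ 1 1) = q ^ 2 • θθ 1 1 := rightLift_θθ _ 1 1
  have hτ : ∀ (t : TwoTensor) (a : Plane), τ (t <• a) = τ t <• a := rightLift_right_smul _
  refine Function.bijective_iff_has_inverse.2 ⟨τ, fun t => ?_, fun t => ?_⟩ <;>
  · obtain ⟨c, rfl, -⟩ := existsUnique_coeff t
    simp only [map_sum, σ_right_smul, hτ]
    refine Finset.sum_congr rfl fun j _ => Finset.sum_congr rfl fun k _ => ?_
    congr 1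
    fin_cases j <;> fin_cases k <;>
      simp only [Fin.zero_eta, Fin.mk_one, σ_ξξ, σ_ξη, σ_ηξ, σ_ηη, h00, h01, h10, h11, map_sub,
        map_add, map_smul] <;>
      match_scalars <;> field_simp <;> ring

/-! ### Formal inverses of `x` and `y` -/

/-- The relations between the generators `0, 1, 2, 3`, standing for `x, y, x⁻¹, y⁻¹`. -/
inductive TorusRel : FreeAlgebra ℂ (Fin 4) → FreeAlgebra ℂ (Fin 4) → Prop
  | comm : TorusRel (FreeAlgebra.ι ℂ 0 * FreeAlgebra.ι ℂ 1)
      (q • (FreeAlgebra.ι ℂ 1 * FreeAlgebra.ι ℂ 0))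
  | x_mul_inv : TorusRel (FreeAlgebra.ι ℂ 0 * FreeAlgebra.ι ℂ 2) 1
  | inv_mul_x : TorusRel (FreeAlgebra.ι ℂ 2 * FreeAlgebra.ι ℂ 0) 1
  | y_mul_inv : TorusRel (FreeAlgebra.ι ℂ 1 * FreeAlgebra.ι ℂ 3) 1
  | inv_mul_y : TorusRel (FreeAlgebra.ι ℂ 3 * FreeAlgebra.ι ℂ 1) 1

/-- The algebra obtained from the quantum plane by adjoining inverses of `x` and `y`. -/
def Torus : Type := RingQuot TorusRel

instance : Ring Torus := inferInstanceAs (Ring (RingQuot TorusRel))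

instance : Algebra ℂ Torus := inferInstanceAs (Algebra ℂ (RingQuot TorusRel))

/-- The generators `x, y, x⁻¹, y⁻¹`. -/
def torusGen (i : Fin 4) : Torus := RingQuot.mkAlgHom ℂ TorusRel (FreeAlgebra.ι ℂ i)

theorem torus_comm : torusGen 0 * torusGen 1 = q • (torusGen 1 * torusGen 0) := by
  have h := RingQuot.mkAlgHom_rel ℂ TorusRel.comm
  rw [map_mul, map_smul, map_mul] at h
  exact h

theorem torus_x_mul_inv : torusGen 0 * torusGen 2 = 1 := by
  have h := RingQuot.mkAlgHom_rel ℂ TorusRel.x_mul_inv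
  rw [map_mul, map_one] at h
  exact h

theorem torus_inv_mul_x : torusGen 2 * torusGen 0 = 1 := by
  have h := RingQuot.mkAlgHom_rel ℂ TorusRel.inv_mul_x
  rw [map_mul, map_one] at h
  exact h

theorem torus_y_mul_inv : torusGen 1 * torusGen 3 = 1 := by
  have h := RingQuot.mkAlgHom_rel ℂ TorusRel.y_mul_inv
  rw [map_mul, map_one] at h
  exact h

theorem torus_inv_mul_y : torusGen 3 * torusGen 1 = 1 := by
  have h := RingQuot.mkAlgHom_rel ℂ TorusRel.inv_mul_y
  rw [map_mul, map_one] at h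
  exact h

/-- The canonical homomorphism from the quantum plane. -/
def toTorus : Plane →ₐ[ℂ] Torus := liftPlane (torusGen 0) (torusGen 1) torus_comm

/-- `x`, `y`, `x⁻¹`, `y⁻¹` in the localized algebra. -/
abbrev tx : Torus := torusGen 0
/-- See `tx`. -/
abbrev ty : Torus := torusGen 1
/-- See `tx`. -/
abbrev txi : Torus := torusGen 2
/-- See `tx`. -/
abbrev tyi : Torus := torusGen 3

/-! ### Christoffel symbols

All indices are shifted by one: `Γ i j k` is the Christoffel symbol with upper index `i + 1` and
lower indices `j + 1`, `k + 1`. -/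

/-- `Γ` are the Christoffel symbols of the map `nabla`: `∇θ^i = ∑ θ^j ⊗ θ^k Γ^i_{jk}`. -/
def HasChristoffel (nabla : OneForm →ₗ[ℂ] TwoTensor) (Γ : Fin 2 → Fin 2 → Fin 2 → Plane) : Prop :=
  ∀ i, nabla (θ i) = ∑ j, ∑ k, θθ j k <• Γ i j k

/-- The divisibility conditions on the left Christoffel symbols. The last one is
`(q - 1) Γ²₁₂ + (1 - q²) Γ²₂₁ + 3 q² y x⁻¹ Γ²₂₂ ∈ x A`, read in the localized algebra. -/
structure DivisibilityConditions (Γ : Fin 2 → Fin 2 → Fin 2 → Plane) : Prop where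
  c112 : ∃ a, Γ 0 0 1 = x * a
  c121 : ∃ a, Γ 0 1 0 = x * a
  c122 : ∃ a, Γ 0 1 1 = x ^ 2 * a
  c222 : ∃ a, Γ 1 1 1 = x * a
  comb : ∃ a, (q - 1) • toTorus (Γ 1 0 1) + (1 - q ^ 2) • toTorus (Γ 1 1 0) +
      (3 * q ^ 2) • (ty * txi * toTorus (Γ 1 1 1)) = tx * toTorus a

/-- The formulas, in the localized algebra, expressing the right Christoffel symbols `Γt`
through the left Christoffel symbols `Γ`. -/
structure RightSymbolFormulas (Γ Γt : Fin 2 → Fin 2 → Fin 2 → Plane) : Prop where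
  e111 : toTorus (Γt 0 0 0) =
    q ^ 2 • (tx * ty * toTorus (Γ 0 0 0) * tyi * txi) +
    (1 - q) • (ty ^ 2 * toTorus (Γ 0 0 1) * tyi * txi) +
    (q ^ 2 - 1) • (ty ^ 2 * toTorus (Γ 0 1 0) * tyi * txi)
  e112 : toTorus (Γt 0 0 1) =
    (q ^ 2 - 1) • (tx * ty * toTorus (Γ 0 0 1) * tyi * txi) +
    q • (tx * ty * toTorus (Γ 0 1 0) * tyi * txi) +
    (q - q ^ 2) • (ty ^ 2 * toTorus (Γ 0 1 1) * tyi * txi)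
  e121 : toTorus (Γt 0 1 0) =
    q • (tx * ty * toTorus (Γ 0 0 1) * tyi * txi) +
    (1 - q) • (ty ^ 2 * toTorus (Γ 0 1 1) * tyi * txi)
  e122 : toTorus (Γt 0 1 1) =
    q ^ 2 • (tx * ty * toTorus (Γ 0 1 1) * tyi * txi)
  e211 : toTorus (Γt 1 0 0) =
    tx * ty * toTorus (Γ 0 0 0) * txi ^ 2 -
    tx * toTorus (Γ 0 0 0) * ty * txi ^ 2 +
    (q - 1) • (ty * toTorus (Γ 0 0 1) * ty * txi ^ 2) +
    (q - q ^ 2) • (ty ^ 2 * toTorus (Γ 0 0 1) * txi ^ 2) +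
    (1 - q ^ 2) • (ty * toTorus (Γ 0 1 0) * ty * txi ^ 2) +
    (1 - q) • (ty ^ 2 * toTorus (Γ 0 1 0) * txi ^ 2) +
    q ^ 2 • (tx ^ 2 * ty ^ 2 * toTorus (Γ 1 0 0) * tyi ^ 2 * txi ^ 2) +
    (q - 1) • (tx * toTorus (Γ 1 0 1) * ty * txi ^ 2) +
    (1 - q ^ 2) • (tx * toTorus (Γ 1 1 0) * ty * txi ^ 2) +
    (3 : ℂ) • (ty * toTorus (Γ 1 1 1) * ty * txi ^ 2)
  e212 : toTorus (Γt 1 0 1) =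
    (1 - q ^ 2) • (tx * toTorus (Γ 0 0 1) * ty * txi ^ 2) +
    (q ^ 2 - 1) • (ty ^ 2 * toTorus (Γ 0 1 1) * txi ^ 2) +
    (1 - q) • (tx * ty * toTorus (Γ 0 0 1) * txi ^ 2) +
    q ^ 2 • (tx * ty * toTorus (Γ 0 1 0) * txi ^ 2) -
    q • (tx * toTorus (Γ 0 1 0) * ty * txi ^ 2) +
    (q - 1) • (ty * toTorus (Γ 0 1 1) * ty * txi ^ 2) +
    (q ^ 2 - 1) • (tx ^ 2 * ty ^ 2 * toTorus (Γ 1 0 1) * tyi ^ 2 * txi ^ 2) +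
    q • (tx ^ 2 * ty ^ 2 * toTorus (Γ 1 1 0) * tyi ^ 2 * txi ^ 2) +
    (q ^ 2 - q) • (tx * toTorus (Γ 1 1 1) * ty * txi ^ 2)
  e221 : toTorus (Γt 1 1 0) =
    q ^ 2 • (tx * ty * toTorus (Γ 0 0 1) * txi ^ 2) -
    q • (tx * toTorus (Γ 0 0 1) * ty * txi ^ 2) +
    (1 - q ^ 2) • (ty * toTorus (Γ 0 1 1) * ty * txi ^ 2) +
    (q - q ^ 2) • (ty ^ 2 * toTorus (Γ 0 1 1) * txi ^ 2) +
    q • (tx ^ 2 * ty ^ 2 * toTorus (Γ 1 0 1) * tyi ^ 2 * txi ^ 2) +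
    (q - 1) • (tx * toTorus (Γ 1 1 1) * ty * txi ^ 2)
  e222 : toTorus (Γt 1 1 1) =
    tx * ty * toTorus (Γ 0 1 1) * txi ^ 2 -
    q • (tx * toTorus (Γ 0 1 1) * ty * txi ^ 2) +
    q ^ 2 • (tx ^ 2 * ty ^ 2 * toTorus (Γ 1 1 1) * tyi ^ 2 * txi ^ 2)

end QuantumPlane

end

open QuantumPlane

namespace QuantumPlane

/-! Compatibility is a condition on the centre of the bimodule of one-forms, so the centre is
computed first. Since `q` is a primitive cube root of unity, `x ^ 3` and `y ^ 3` are central in `A`,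
commute with all one-forms and are killed by `d`. The centre is generated over `ℂ[x ^ 3, y ^ 3]` by
two forms, `ξ x y` and `η x² y² - q ξ x y³` (`bimoduleCentre_subset_span`). Both connections are
linear over these constants, so compatibility amounts to two equations, one for each generator
(`sigmaCompatible_iff`).

Each generator can also be written with its coefficients on the left. Applying the left Leibniz rule
to one form and the right Leibniz rule to the other produces differential terms, and these match
under `σ` (`differential_zero`, `differential_one`). What remains is algebraic. The first equation
relates `(x y) ∇^L ξ` to `σ (∇^R ξ · x y)` and determines the right symbols with upper index 1.
After substituting these, the second determines those with upper index 2. Because `x`, `y` and `σ`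
are invertible, the solution in the quantum torus is unique and is given by the stated formulas
(`zero_symbols_iff`, `one_symbols_iff`), which proves (3).

The plane embeds in the torus (`toTorus_injective`), so the right symbols are unique, and a right
connection is determined by its symbols. This proves (2). Any choice of symbols in `A` defines a
right connection, so existence means that all eight formulas take values in `A`, that is, have no
coefficients at negative exponents. The only exponents of `x` that can cause trouble are `-1` and
`-2`. The vanishing of these coefficients is a linear system in the low-order coefficients of `Γ`,
equivalent to the divisibility conditions (`divisibilityConditions_iff_exists`), which gives (1).

All calculations in the torus are made on coefficients of `x ^ m * y ^ n`. Each becomes a polynomial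
identity in `q`, `U = q ^ m` and `V = q ^ n`, subject to `q ^ 2 + q + 1 = 0` and `U ^ 3 = V ^ 3 =
1`. -/

theorem q_relation : q ^ 2 + q + 1 = 0 := by
  have h : IsPrimitiveRoot q 3 := by
    have := Complex.isPrimitiveRoot_exp 3 (by norm_num)
    simpa [q] using this
  have := h.geom_sum_eq_zero (by norm_num)
  simp [Finset.sum_range_succ] at this
  linear_combination this

theorem q_inv : q⁻¹ = q ^ 2 := by
  have := q_pow_three
  field_simp [q_ne_zero]
  linear_combination -this

/-! ### Coefficients with respect to the monomials `x ^ m * y ^ n` -/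

/-- Finitely supported functions on the exponents of Laurent monomials. -/
abbrev Lattice : Type := ℤ × ℤ →₀ ℂ

/-- The shift of exponents by `s`, weighted by `w`. -/
noncomputable def weightedShift (s : ℤ × ℤ) (w : ℤ × ℤ → ℂ) : Lattice →ₗ[ℂ] Lattice :=
  Finsupp.lsum ℂ fun p => w p • Finsupp.lsingle (p + s)

theorem weightedShift_single (s : ℤ × ℤ) (w : ℤ × ℤ → ℂ) (p : ℤ × ℤ) (c : ℂ) :
    weightedShift s w (Finsupp.single p c) = w p • Finsupp.single (p + s) c := by
  simp [weightedShift]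

@[simp]
theorem weightedShift_apply (s : ℤ × ℤ) (w : ℤ × ℤ → ℂ) (f : Lattice) (p : ℤ × ℤ) :
    weightedShift s w f p = w (p - s) * f (p - s) := by
  induction f using Finsupp.induction_linear with
  | zero => simp
  | add f g hf hg => rw [map_add, Finsupp.add_apply, hf, hg, Finsupp.add_apply, mul_add]
  | single r c =>
    rw [weightedShift_single, Finsupp.smul_apply, smul_eq_mul]
    by_cases h : p = r + s
    · subst h; simp
    · have h' : r ≠ p - s := fun e => h (by rw [e]; simp)
      simp [h', Ne.symm h]

/-! ### Left and right multiplication on Laurent coefficients. -/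

theorem torus_induction {P : Torus → Prop} (t : Torus) (hc : ∀ c : ℂ, P (algebraMap ℂ Torus c))
    (hgen : ∀ i, P (torusGen i)) (hadd : ∀ a b, P a → P b → P (a + b))
    (hmul : ∀ a b, P a → P b → P (a * b)) : P t := by
  obtain ⟨t, rfl⟩ := RingQuot.mkAlgHom_surjective ℂ TorusRel t
  induction t using FreeAlgebra.induction with
  | grade0 c => rw [AlgHom.commutes]; exact hc c
  | grade1 i => exact hgen i
  | mul a b ha hb => rw [map_mul]; exact hmul _ _ ha hb
  | add a b ha hb => rw [map_add]; exact hadd _ _ ha hb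

/-- The operators by which `x`, `y`, `x⁻¹`, `y⁻¹` act on Laurent monomials from the left. -/
noncomputable def leftGen : Fin 4 → Module.End ℂ Lattice :=
  ![weightedShift (1, 0) 1, weightedShift (0, 1) fun p => q ^ (-p.1),
    weightedShift (-1, 0) 1, weightedShift (0, -1) fun p => q ^ p.1]

/-- The regular representation of the quantum torus on Laurent monomials. -/
noncomputable def torusRep : Torus →ₐ[ℂ] Module.End ℂ Lattice :=
  RingQuot.liftAlgHom ℂ ⟨FreeAlgebra.lift ℂ leftGen, by
    have hq := q_ne_zero
    rintro _ _ (_ | _) <;> refine LinearMap.ext fun v => Finsupp.ext fun ⟨m, n⟩ => ?_ <;>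
      simp [leftGen] <;> field_simp
    rw [zpow_sub_one₀ hq]
    field_simp⟩

@[simp]
theorem torusRep_gen (i : Fin 4) : torusRep (torusGen i) = leftGen i := by
  change RingQuot.liftAlgHom ℂ _ (RingQuot.mkAlgHom ℂ TorusRel _) = _
  simp

/-- The coefficients of an element of the quantum torus with respect to the Laurent monomials. -/
noncomputable def coeff : Torus →ₗ[ℂ] Lattice where
  toFun t := torusRep t (Finsupp.single 0 1)
  map_add' := by simp
  map_smul' := by simp

theorem coeff_tx_mul (t : Torus) (m n : ℤ) : coeff (tx * t) (m, n) = coeff t (m - 1, n) := by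
  simp [coeff, leftGen]

theorem coeff_txi_mul (t : Torus) (m n : ℤ) : coeff (txi * t) (m, n) = coeff t (m + 1, n) := by
  simp [coeff, leftGen]

theorem coeff_ty_mul (t : Torus) (m n : ℤ) :
    coeff (ty * t) (m, n) = q ^ (-m) * coeff t (m, n - 1) := by
  simp [coeff, leftGen]

/-- The operators by which `x`, `y`, `x⁻¹`, `y⁻¹` act on Laurent monomials from the right. -/
noncomputable def rightGen : Fin 4 → Module.End ℂ Lattice :=
  ![weightedShift (1, 0) fun p => q ^ (-p.2), weightedShift (0, 1) 1,
    weightedShift (-1, 0) fun p => q ^ p.2, weightedShift (0, -1) 1]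

/-- Left and right multiplications commute. It suffices to test generators, where both sides are
weighted shifts. This is what yields the coefficient rules for multiplication on the right, since
the operators `leftGen i` and `rightGen i` agree on the unit monomial. -/
theorem torusRep_rightGen (t : Torus) (i : Fin 4) (v : Lattice) :
    torusRep t (rightGen i v) = rightGen i (torusRep t v) := by
  have hq := q_ne_zero
  induction t using torus_induction generalizing v with
  | hc c => simp [Algebra.algebraMap_eq_smul_one]
  | hgen j =>
    ext ⟨m, n⟩
    fin_cases i <;> fin_cases j <;>
      simp [leftGen, rightGen] <;> simp only [zpow_add₀ hq, zpow_sub₀ hq, zpow_one] <;> field_simp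
  | hadd a b ha hb => simp [ha, hb]
  | hmul a b ha hb => simp [ha, hb]

theorem coeff_mul_gen (t : Torus) (i : Fin 4) : coeff (t * torusGen i) = rightGen i (coeff t) := by
  change torusRep _ _ = rightGen i (torusRep _ _)
  rw [← torusRep_rightGen, map_mul, torusRep_gen, Module.End.mul_apply]
  congr 1
  fin_cases i <;> simp [leftGen, rightGen, weightedShift_single]

theorem coeff_mul_tx (t : Torus) (m n : ℤ) :
    coeff (t * tx) (m, n) = q ^ (-n) * coeff t (m - 1, n) := by
  simp [coeff_mul_gen, rightGen]

theorem coeff_mul_txi (t : Torus) (m n : ℤ) :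
    coeff (t * txi) (m, n) = q ^ n * coeff t (m + 1, n) := by
  simp [coeff_mul_gen, rightGen]

theorem coeff_mul_ty (t : Torus) (m n : ℤ) : coeff (t * ty) (m, n) = coeff t (m, n - 1) := by
  simp [coeff_mul_gen, rightGen]

theorem coeff_mul_tyi (t : Torus) (m n : ℤ) : coeff (t * tyi) (m, n) = coeff t (m, n + 1) := by
  simp [coeff_mul_gen, rightGen]

/-- `x` as a unit of the quantum torus. -/
noncomputable def txUnit : Torusˣ := ⟨tx, txi, torus_x_mul_inv, torus_inv_mul_x⟩

/-- `y` as a unit of the quantum torus. -/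
noncomputable def tyUnit : Torusˣ := ⟨ty, tyi, torus_y_mul_inv, torus_inv_mul_y⟩

/-- The Laurent monomial `x ^ m * y ^ n`. -/
noncomputable def laurentMonomial (p : ℤ × ℤ) : Torus :=
  ((txUnit ^ p.1 * tyUnit ^ p.2 : Torusˣ) : Torus)

/-! ### Laurent monomials span the quantum torus. -/

theorem ty_mul_tx : ty * tx = q⁻¹ • (tx * ty) := by
  rw [torus_comm, smul_smul, inv_mul_cancel₀ q_ne_zero, one_smul]

theorem ty_mul_zpow (m : ℤ) :
    ty * (txUnit ^ m : Torusˣ) = q ^ (-m) • ((txUnit ^ m : Torusˣ) * ty) := by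
  have hq := q_ne_zero
  have h (m : ℤ) : ((txUnit ^ (m + 1) : Torusˣ) : Torus) = (txUnit ^ m : Torusˣ) * tx := by
    rw [zpow_add_one, Units.val_mul]; rfl
  induction m using Int.induction_on with
  | zero => simp
  | succ m ih =>
    rw [h, ← mul_assoc, ih, smul_mul_assoc, mul_assoc, ty_mul_tx, mul_smul_comm, smul_smul,
      neg_add, zpow_add₀ hq, zpow_neg_one, mul_assoc]
  | pred m ih =>
    have h' := h (-m - 1)
    rw [sub_add_cancel] at h'
    rw [h', ← mul_assoc] at ih
    have e : ty * ((txUnit ^ (-(m : ℤ) - 1) : Torusˣ) : Torus) =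
        (ty * ((txUnit ^ (-(m : ℤ) - 1) : Torusˣ) : Torus) * tx) * txi := by
      rw [mul_assoc, torus_x_mul_inv, mul_one]
    rw [e, ih, mul_assoc _ tx ty, torus_comm, mul_smul_comm, smul_smul, smul_mul_assoc,
      mul_assoc, mul_assoc, torus_x_mul_inv, mul_one, ← zpow_add_one₀ hq]
    congr 2
    ring

theorem gen_mul_laurentMonomial (i : Fin 4) (p : ℤ × ℤ) :
    torusGen i * laurentMonomial p =
      Finsupp.linearCombination ℂ laurentMonomial (leftGen i (Finsupp.single p 1)) := by
  have hq := q_ne_zero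
  have hx (m : ℤ) : tx * ((txUnit ^ m : Torusˣ) : Torus) = (txUnit ^ (m + 1) : Torusˣ) := by
    rw [add_comm, zpow_one_add, Units.val_mul]; rfl
  have hy (m : ℤ) : ty * ((tyUnit ^ m : Torusˣ) : Torus) = (tyUnit ^ (m + 1) : Torusˣ) := by
    rw [add_comm, zpow_one_add, Units.val_mul]; rfl
  have hX (p : ℤ × ℤ) : tx * laurentMonomial p = laurentMonomial (p + (1, 0)) := by
    simp only [laurentMonomial, Units.val_mul, ← mul_assoc, hx]; simp
  have hY (p : ℤ × ℤ) : ty * laurentMonomial p = q ^ (-p.1) • laurentMonomial (p + (0, 1)) := by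
    simp only [laurentMonomial, Units.val_mul, ← mul_assoc, ty_mul_zpow, smul_mul_assoc]
    rw [mul_assoc, hy]; simp
  fin_cases i
  · simpa [leftGen, weightedShift_single] using hX p
  · simpa [leftGen, weightedShift_single] using hY p
  · have := hX (p + (-1, 0))
    rw [add_assoc, show ((-1, 0) + (1, 0) : ℤ × ℤ) = 0 by rfl, add_zero] at this
    simp only [Fin.reduceFinMk, leftGen, Matrix.cons_val, weightedShift_single, ← this]
    simp
    rw [← mul_assoc, torus_inv_mul_x, one_mul]
  · have := hY (p + (0, -1))
    rw [add_assoc, show ((0, -1) + (0, 1) : ℤ × ℤ) = 0 by rfl, add_zero] at this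
    simp at this
    have h2 : laurentMonomial p = q ^ p.1 • (ty * laurentMonomial (p + (0, -1))) := by
      rw [this, smul_smul, mul_inv_cancel₀ (zpow_ne_zero _ hq), one_smul]
    simp [leftGen, weightedShift_single]
    rw [h2, mul_smul_comm, ← mul_assoc, torus_inv_mul_y, one_mul]

/-- Summation against Laurent monomials intertwines the representation with left multiplication.
Evaluated at the unit monomial it recovers `t` from `coeff t`, so `coeff` is injective. -/
theorem linearCombination_torusRep (t : Torus) (v : Lattice) :
    Finsupp.linearCombination ℂ laurentMonomial (torusRep t v) =
      t * Finsupp.linearCombination ℂ laurentMonomial v := by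
  induction t using torus_induction generalizing v with
  | hc c => simp [Algebra.algebraMap_eq_smul_one]
  | hgen j =>
    induction v using Finsupp.induction_linear with
    | zero => simp
    | add f g hf hg => simp only [map_add, hf, hg, mul_add]
    | single p c =>
      rw [← mul_one c, ← smul_eq_mul, ← Finsupp.smul_single, map_smul, map_smul, map_smul,
        torusRep_gen, ← gen_mul_laurentMonomial]
      simp
  | hadd a b ha hb => simp [ha, hb, add_mul]
  | hmul a b ha hb => simp [ha, hb, mul_assoc]

theorem linearCombination_coeff (t : Torus) :
    Finsupp.linearCombination ℂ laurentMonomial (coeff t) = t := by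
  change Finsupp.linearCombination ℂ laurentMonomial (torusRep t _) = t
  rw [linearCombination_torusRep]
  simp [laurentMonomial]

theorem torus_ext {s t : Torus} (h : ∀ m n, coeff s (m, n) = coeff t (m, n)) : s = t := by
  rw [← linearCombination_coeff s, ← linearCombination_coeff t]
  congr 1
  ext ⟨m, n⟩
  exact h m n

/-! ### The quantum plane inside the quantum torus. -/

@[simp] theorem toTorus_x : toTorus x = tx := liftPlane_x _ _ _

@[simp] theorem toTorus_y : toTorus y = ty := liftPlane_y _ _ _

/-- The image in the quantum plane of a combination of Laurent monomials; those with a negative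
exponent are dropped. -/
noncomputable def latticeToPlane : Lattice →ₗ[ℂ] Plane :=
  Finsupp.linearCombination ℂ fun p =>
    if 0 ≤ p.1 ∧ 0 ≤ p.2 then x ^ p.1.toNat * y ^ p.2.toNat else 0

/-- Combinations of monomials with nonnegative exponents. -/
noncomputable abbrev nonnegLattice : Submodule ℂ Lattice :=
  Finsupp.supported ℂ ℂ {p | 0 ≤ p.1 ∧ 0 ≤ p.2}

theorem nonneg_induction {P : Lattice → Prop} {v : Lattice} (hv : v ∈ nonnegLattice)
    (h : ∀ (m n : ℕ), P (Finsupp.single ((m : ℤ), (n : ℤ)) 1)) (h0 : P 0)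
    (hadd : ∀ u v, P u → P v → P (u + v)) (hsmul : ∀ (c : ℂ) u, P u → P (c • u)) : P v := by
  rw [nonnegLattice, Finsupp.supported_eq_span_single] at hv
  refine Submodule.span_induction ?_ h0 (fun u v _ _ => hadd u v) (fun c u _ => hsmul c u) hv
  rintro _ ⟨⟨m, n⟩, ⟨hm, hn⟩, rfl⟩
  lift m to ℕ using hm
  lift n to ℕ using hn
  exact h m n

theorem y_mul_x : y * x = q⁻¹ • (x * y) := by
  rw [x_mul_y, smul_smul, inv_mul_cancel₀ q_ne_zero, one_smul]

theorem y_mul_x_pow (m : ℕ) : y * x ^ m = (q ^ m)⁻¹ • (x ^ m * y) := by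
  induction m with
  | zero => simp
  | succ m ih =>
    rw [pow_succ, ← mul_assoc, ih, smul_mul_assoc, mul_assoc, y_mul_x, mul_smul_comm, smul_smul,
      mul_assoc, pow_succ, mul_inv]

/-- `x` and `y` only raise exponents, and on nonnegative exponents `latticeToPlane` intertwines
their action with left multiplication in the plane. Starting from the unit monomial, this makes
`latticeToPlane ∘ coeff` a left inverse of `toTorus`, and no basis theorem for the plane is needed
beforehand. -/
theorem torusRep_toTorus (a : Plane) {v : Lattice} (hv : v ∈ nonnegLattice) :
    torusRep (toTorus a) v ∈ nonnegLattice ∧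
      latticeToPlane (torusRep (toTorus a) v) = a * latticeToPlane v := by
  induction a using plane_induction generalizing v with
  | hc c =>
    simp only [Algebra.algebraMap_eq_smul_one, LinearMap.smul_apply, map_one,
      Module.End.one_apply, map_smul, smul_mul_assoc, one_mul, and_true]
    exact Submodule.smul_mem _ _ hv
  | hx =>
    refine nonneg_induction
      (P := fun v => torusRep (toTorus _) v ∈ nonnegLattice ∧
        latticeToPlane (torusRep (toTorus _) v) = _ * latticeToPlane v)
      hv (fun m n => ?_) (by simp) (fun u v hu hv => ?_) (fun c u hu => ?_)
    · have : (((m : ℤ), (n : ℤ)) + (1, 0) : ℤ × ℤ) = (((m + 1 : ℕ) : ℤ), (n : ℤ)) := by simp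
      simp only [toTorus_x, torusRep_gen, leftGen, Matrix.cons_val_zero, weightedShift_single, this]
      constructor
      · simpa using Finsupp.single_mem_supported ℂ _ (by simp; omega)
      · simp [latticeToPlane, pow_succ', mul_assoc]
        omega
    · simp only [map_add, hu.2, hv.2, mul_add, and_true]
      exact Submodule.add_mem _ hu.1 hv.1
    · simp only [map_smul, hu.2, mul_smul_comm, and_true]
      exact Submodule.smul_mem _ _ hu.1
  | hy =>
    refine nonneg_induction
      (P := fun v => torusRep (toTorus _) v ∈ nonnegLattice ∧
        latticeToPlane (torusRep (toTorus _) v) = _ * latticeToPlane v)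
      hv (fun m n => ?_) (by simp) (fun u v hu hv => ?_) (fun c u hu => ?_)
    · have : (((m : ℤ), (n : ℤ)) + (0, 1) : ℤ × ℤ) = ((m : ℤ), ((n + 1 : ℕ) : ℤ)) := by simp
      simp only [toTorus_y, torusRep_gen, leftGen, Matrix.cons_val_one, Matrix.cons_val_zero,
        weightedShift_single, this]
      constructor
      · exact Submodule.smul_mem _ _ (Finsupp.single_mem_supported ℂ _ (by simp; omega))
      · simp [latticeToPlane, pow_succ', ← mul_assoc, y_mul_x_pow]
        omega
    · simp only [map_add, hu.2, hv.2, mul_add, and_true]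
      exact Submodule.add_mem _ hu.1 hv.1
    · simp only [map_smul, hu.2, mul_smul_comm, and_true]
      exact Submodule.smul_mem _ _ hu.1
  | hadd a b ha hb =>
    simp only [map_add, LinearMap.add_apply, (ha hv).2, (hb hv).2, add_mul, and_true]
    exact Submodule.add_mem _ (ha hv).1 (hb hv).1
  | hmul a b ha hb =>
    simp only [map_mul, Module.End.mul_apply, (ha (hb hv).1).2, (hb hv).2, mul_assoc, and_true]
    exact (ha (hb hv).1).1

theorem coeff_toTorus_mem (a : Plane) : coeff (toTorus a) ∈ nonnegLattice :=
  (torusRep_toTorus a (Finsupp.single_mem_supported ℂ _ (by simp))).1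

theorem latticeToPlane_coeff (a : Plane) : latticeToPlane (coeff (toTorus a)) = a := by
  refine (torusRep_toTorus a (Finsupp.single_mem_supported ℂ _ (by simp))).2.trans ?_
  simp [latticeToPlane]

theorem toTorus_injective : Function.Injective toTorus := fun a b h => by
  rw [← latticeToPlane_coeff a, h, latticeToPlane_coeff]

theorem coeff_toTorus_of_neg (a : Plane) {m n : ℤ} (h : m < 0 ∨ n < 0) :
    coeff (toTorus a) (m, n) = 0 := by
  by_contra hne
  have := (Finsupp.mem_supported _ _).1 (coeff_toTorus_mem a) (Finsupp.mem_support_iff.2 hne)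
  simp at this
  omega

theorem toTorus_latticeToPlane {v : Lattice} (hv : v ∈ nonnegLattice) :
    toTorus (latticeToPlane v) = Finsupp.linearCombination ℂ laurentMonomial v := by
  refine nonneg_induction
    (P := fun v => toTorus (latticeToPlane v) = Finsupp.linearCombination ℂ laurentMonomial v)
    hv (fun m n => ?_) (by simp) (fun u v hu hv => by simp [hu, hv])
    (fun c u hu => by simp [hu])
  simp [latticeToPlane, laurentMonomial]
  rfl

theorem exists_toTorus_eq {t : Torus} (h : ∀ m n, m < 0 ∨ n < 0 → coeff t (m, n) = 0) :
    ∃ a, toTorus a = t := by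
  refine ⟨latticeToPlane (coeff t), ?_⟩
  rw [toTorus_latticeToPlane, linearCombination_coeff]
  refine (Finsupp.mem_supported _ _).2 fun p hp => ?_
  by_contra hn
  refine Finsupp.mem_support_iff.1 hp (h p.1 p.2 ?_)
  simp at hn
  omega

theorem mem_span_monomials {a : Plane} {S : Set (ℕ × ℕ)}
    (h : ∀ m n : ℕ, (m, n) ∉ S → coeff (toTorus a) ((m : ℤ), (n : ℤ)) = 0) :
    a ∈ Submodule.span ℂ ((fun p : ℕ × ℕ => x ^ p.1 * y ^ p.2) '' S) := by
  rw [← latticeToPlane_coeff a, latticeToPlane, Finsupp.linearCombination_apply]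
  refine Submodule.sum_mem _ fun p hp => Submodule.smul_mem _ _ ?_
  split_ifs with h0
  · refine Submodule.subset_span ⟨(p.1.toNat, p.2.toNat), ?_, rfl⟩
    by_contra hn
    refine Finsupp.mem_support_iff.1 hp ?_
    have := h _ _ hn
    simpa [Int.toNat_of_nonneg h0.1, Int.toNat_of_nonneg h0.2] using this
  · exact Submodule.zero_mem _

/-! ### The centre of the bimodule of one-forms -/

theorem x_pow_three_mul (a : Plane) : x ^ 3 * a = a * x ^ 3 := by
  induction a using plane_induction with
  | hc c => exact (Algebra.commutes c _).symm
  | hx => rw [← pow_succ, ← pow_succ']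
  | hy =>
    rw [y_mul_x_pow, q_pow_three, inv_one, one_smul]
  | hadd a b ha hb => rw [mul_add, add_mul, ha, hb]
  | hmul a b ha hb => rw [← mul_assoc, ha, mul_assoc, hb, mul_assoc]

theorem x_mul_y_pow (n : ℕ) : x * y ^ n = q ^ n • (y ^ n * x) := by
  induction n with
  | zero => simp
  | succ n ih =>
    rw [pow_succ, ← mul_assoc, ih, smul_mul_assoc, mul_assoc, x_mul_y, mul_smul_comm, smul_smul,
      mul_assoc, pow_succ]

theorem y_pow_three_mul (a : Plane) : y ^ 3 * a = a * y ^ 3 := by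
  induction a using plane_induction with
  | hc c => exact (Algebra.commutes c _).symm
  | hx => rw [x_mul_y_pow, q_pow_three, one_smul]
  | hy => rw [← pow_succ, ← pow_succ']
  | hadd a b ha hb => rw [mul_add, add_mul, ha, hb]
  | hmul a b ha hb => rw [← mul_assoc, ha, mul_assoc, hb, mul_assoc]

theorem y_mul_x_mul (a : Plane) : y * (x * a) = q⁻¹ • (x * (y * a)) := by
  rw [← mul_assoc, y_mul_x, smul_mul_assoc, mul_assoc]

theorem commutation_x : commutation x = !![q ^ 2 • x, (q ^ 2 - 1) • y; 0, q • x] :=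
  liftPlane_x _ _ _

theorem commutation_y : commutation y = !![q • y, 0; 0, q ^ 2 • y] := liftPlane_y _ _ _

/-- The elements of the quantum plane that act centrally on one-forms and are killed by `d`. -/
def centralConstants : Submonoid Plane where
  carrier := {z | d z = 0 ∧ ∀ ω : OneForm, z • ω = ω <• z}
  one_mem' := by
    constructor
    · change (graphOfD 1).snd = 0
      simp
    · intro ω
      simp
  mul_mem' := by
    rintro z w ⟨hz, hz'⟩ ⟨hw, hw'⟩
    refine ⟨by rw [d_mul, hz, hw]; simp, fun ω => ?_⟩
    rw [mul_smul, hw', smul_comm, hz', MulOpposite.op_mul, mul_smul]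

theorem d_apply_pow_three (a : Plane) :
    d (a ^ 3) = a • a • d a + a • (d a <• a) + d a <• a <• a := by
  simp only [pow_succ, pow_zero, one_mul, d_mul, mul_smul, smul_add]
  rw [smul_comm a (MulOpposite.op a), add_assoc]

theorem x_pow_three_mem : x ^ 3 ∈ centralConstants := by
  have h3 := q_pow_three
  have hr := q_relation
  constructor
  · rw [d_apply_pow_three, d_x]
    funext i
    fin_cases i <;> simp [OneForm.add_apply, OneForm.left_smul_apply, OneForm.right_smul_apply,
      θ_apply, commutation_x, OneForm.zero_apply]
    match_scalars
    -- Moving `x` past `ξ` costs `q ^ 2`, so the scalar is `q ^ 4 + q ^ 2 + 1 = (q ^ 2 + q + 1) * (q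
    -- ^ 2 - q + 1)`.
    linear_combination (q ^ 2 - q + 1) * hr
  · intro ω
    have hx : commutation (x ^ 3) = !![x ^ 3, 0; 0, x ^ 3] := by
      rw [map_pow, commutation_x]
      ext i j
      fin_cases i <;> fin_cases j <;> simp [pow_three, Matrix.mul_apply, smul_smul, mul_assoc, mul_add,
        y_mul_x, y_mul_x_mul, q_inv]
      all_goals
        match_scalars
        grind
    funext i
    rw [OneForm.left_smul_apply, OneForm.right_smul_apply, hx, ← x_pow_three_mul]
    fin_cases i <;> simp

theorem y_pow_three_mem : y ^ 3 ∈ centralConstants := by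
  have h3 := q_pow_three
  have hr := q_relation
  constructor
  · rw [d_apply_pow_three, d_y]
    funext i
    fin_cases i <;> simp [OneForm.add_apply, OneForm.left_smul_apply, OneForm.right_smul_apply,
      θ_apply, commutation_y, OneForm.zero_apply]
    match_scalars
    linear_combination (q ^ 2 - q + 1) * hr
  · intro ω
    have hy : commutation (y ^ 3) = !![y ^ 3, 0; 0, y ^ 3] := by
      rw [map_pow, commutation_y]
      ext i j
      fin_cases i <;> fin_cases j <;> simp [pow_three, Matrix.mul_apply, smul_smul]
      all_goals
        match_scalars
        grind
    funext i
    rw [OneForm.left_smul_apply, OneForm.right_smul_apply, hy, ← y_pow_three_mul]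
    fin_cases i <;> simp

theorem monomial_mem_centralConstants (i j : ℕ) :
    x ^ (3 * i) * y ^ (3 * j) ∈ centralConstants := by
  rw [pow_mul, pow_mul]
  exact mul_mem (pow_mem x_pow_three_mem i) (pow_mem y_pow_three_mem j)

/-- The two generators of the centre of the bimodule of one-forms. -/
noncomputable def centralForm : Fin 2 → OneForm :=
  ![θ 0 <• (x * y), θ 1 <• (x ^ 2 * y ^ 2) - q • (θ 0 <• (x * y ^ 3))]

theorem OneForm.sub_apply (ω ρ : OneForm) (i : Fin 2) : (ω - ρ) i = ω i - ρ i := rfl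

theorem centralForm_zero_apply (i : Fin 2) : centralForm 0 i = ![x * y, 0] i := by
  fin_cases i <;> simp [centralForm, OneForm.right_smul_apply, θ_apply, -MulOpposite.op_mul]

theorem centralForm_one_apply (i : Fin 2) :
    centralForm 1 i = ![-q • (x * y ^ 3), x ^ 2 * y ^ 2] i := by
  fin_cases i <;> simp [centralForm, OneForm.right_smul_apply, θ_apply, OneForm.sub_apply,
    OneForm.complex_smul_apply, -MulOpposite.op_mul]

/-- The left Leibniz rule needs the coefficients on the left; the definition of `centralForm` has
them on the right. -/
theorem centralForm_zero_left : centralForm 0 = (x * y) • θ 0 := by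
  have h3 := q_pow_three
  funext i
  rw [centralForm_zero_apply]
  fin_cases i <;> simp [OneForm.left_smul_apply, θ_apply, commutation_x, commutation_y,
    Matrix.mul_apply]
  match_scalars
  grind

theorem centralForm_one_left :
    centralForm 1 = (x ^ 2 * y ^ 2) • θ 1 - (x * y ^ 3) • θ 0 := by
  have h3 := q_pow_three
  have hr := q_relation
  funext i
  rw [centralForm_one_apply]
  fin_cases i <;> simp [OneForm.left_smul_apply, OneForm.sub_apply, θ_apply, commutation_x,
    commutation_y, Matrix.mul_apply, pow_succ, mul_assoc, y_mul_x_mul, q_inv]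
  all_goals
    match_scalars
    grind

theorem mem_bimoduleCentre_iff (ζ : OneForm) :
    ζ ∈ bimoduleCentre Plane OneForm ↔ x • ζ = ζ <• x ∧ y • ζ = ζ <• y := by
  refine ⟨fun h => ⟨h x, h y⟩, fun ⟨hx, hy⟩ a => ?_⟩
  induction a using plane_induction with
  | hc c =>
    rw [algebraMap_smul]
    exact (algebraMap_smul Planeᵐᵒᵖ c ζ).symm
  | hx => exact hx
  | hy => exact hy
  | hadd a b ha hb => rw [add_smul, MulOpposite.op_add, add_smul, ha, hb]
  | hmul a b ha hb => rw [mul_smul, hb, smul_comm, ha, MulOpposite.op_mul, mul_smul]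

theorem centralForm_mem (k : Fin 2) : centralForm k ∈ bimoduleCentre Plane OneForm := by
  have h3 := q_pow_three
  have hr := q_relation
  rw [mem_bimoduleCentre_iff]
  constructor <;>
  · funext i
    fin_cases k <;> fin_cases i <;>
      simp [OneForm.left_smul_apply, OneForm.right_smul_apply, centralForm_zero_apply,
        centralForm_one_apply, commutation_x, commutation_y, pow_succ, mul_assoc, y_mul_x,
        y_mul_x_mul, q_inv]
    all_goals
      match_scalars
      grind

/-- The central forms `ζ z`, where `ζ` is one of the two generators of the centre and `z` is a
monomial in `x ^ 3` and `y ^ 3`. -/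
def centralMonomials : Set OneForm :=
  {ω | ∃ (k : Fin 2) (i j : ℕ), ω = centralForm k <• (x ^ (3 * i) * y ^ (3 * j))}

theorem q_zpow_eq_one_iff (k : ℤ) : q ^ k = 1 ↔ 3 ∣ k := by
  have h : IsPrimitiveRoot q 3 := by
    simpa [q] using Complex.isPrimitiveRoot_exp 3 (by norm_num)
  simpa using h.zpow_eq_one_iff_dvd k

theorem coeff_eq_zero_of_smul_eq {t : Torus} {k : ℤ} {m n : ℤ}
    (h : q ^ k * coeff t (m, n) = coeff t (m, n)) (hk : ¬ 3 ∣ k) : coeff t (m, n) = 0 := by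
  by_contra hne
  exact hk ((q_zpow_eq_one_iff k).1 (mul_right_cancel₀ hne (h.trans (one_mul _).symm)))

theorem monomial_mul_central (a b i j : ℕ) :
    x ^ a * y ^ b * (x ^ (3 * i) * y ^ (3 * j)) = x ^ (3 * i + a) * y ^ (3 * j + b) := by
  have h : Commute (x ^ (3 * i)) (y ^ b) := by
    rw [pow_mul]
    exact Commute.pow_left (x_pow_three_mul _) i
  rw [mul_assoc, ← mul_assoc (y ^ b), ← h.eq, ← mul_assoc, ← mul_assoc, ← pow_add, mul_assoc,
    ← pow_add, add_comm a, add_comm b]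

/-- The commutation matrices are triangular, so commuting with `x` and `y` first constrains the
`η`-component alone: a monomial `x ^ m * y ^ n` can occur only if `m` and `n` are both `2` modulo
`3`. These are the `η`-components of multiples of the second generator. Subtracting such a multiple
leaves a central form `ξ a`, and the same argument forces exponents `1` modulo `3` in `a`, giving
multiples of the first generator. -/
theorem bimoduleCentre_subset_span :
    bimoduleCentre Plane OneForm ⊆ Submodule.span ℂ centralMonomials := by
  have hq := q_ne_zero
  intro ζ hζ
  let component (i : Fin 2) : OneForm →ₗ[ℂ] Plane :=
    { toFun := fun ω => ω i, map_add' := fun _ _ => rfl, map_smul' := fun _ _ => rfl }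
  have hb : ζ 1 ∈ (Submodule.span ℂ centralMonomials).map (component 1) := by
    have hx := congrArg toTorus (congrFun (hζ x) 1)
    have hy := congrArg toTorus (congrFun (hζ y) 1)
    simp [OneForm.left_smul_apply, OneForm.right_smul_apply, commutation_x, commutation_y] at hx hy
    rw [Submodule.map_span]
    refine Submodule.span_mono ?_ (mem_span_monomials
      (S := {p | (3 : ℤ) ∣ p.1 + 1 ∧ (3 : ℤ) ∣ p.2 + 1}) fun m n hmn => ?_)
    · rintro _ ⟨⟨m, n⟩, ⟨hm, hn⟩, rfl⟩
      obtain ⟨i, rfl⟩ : ∃ i, m = 3 * i + 2 := ⟨m / 3, by simp at hm; omega⟩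
      obtain ⟨j, rfl⟩ : ∃ j, n = 3 * j + 2 := ⟨n / 3, by simp at hn; omega⟩
      refine ⟨_, ⟨1, i, j, rfl⟩, ?_⟩
      change centralForm 1 1 * _ = _
      rw [centralForm_one_apply]
      exact monomial_mul_central 2 2 i j
    · by_cases hm : (3 : ℤ) ∣ m + 1
      · have := DFunLike.congr_fun (congrArg coeff hx) ((m : ℤ) + 1, (n : ℤ))
        simp [coeff_tx_mul, coeff_mul_tx, -mul_eq_mul_right_iff] at this
        refine coeff_eq_zero_of_smul_eq (k := n + 1) ?_ fun hn => hmn ⟨hm, hn⟩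
        rw [zpow_add_one₀ hq, zpow_natCast, mul_assoc, this]
        field_simp
      · have := DFunLike.congr_fun (congrArg coeff hy) ((m : ℤ), (n : ℤ) + 1)
        simp [coeff_ty_mul, coeff_mul_ty] at this
        refine coeff_eq_zero_of_smul_eq (k := 2 - m) ?_ fun hm' => hm (by omega)
        rw [zpow_sub₀ hq, zpow_natCast, div_eq_mul_inv, mul_assoc]
        exact this
  obtain ⟨ω, hω, hω1⟩ := hb
  have hωc : ω ∈ bimoduleCentre Plane OneForm := by
    intro a
    refine Submodule.span_induction (p := fun ω _ => a • ω = ω <• a) ?_ (by simp) ?_ ?_ hω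
    · rintro _ ⟨k, i, j, rfl⟩
      rw [smul_comm, centralForm_mem k a, ← (monomial_mem_centralConstants i j).2,
        ← (monomial_mem_centralConstants i j).2, smul_comm]
    · intro u v _ _ hu hv
      rw [smul_add, smul_add, hu, hv]
    · intro c u _ hu
      rw [smul_comm, hu, smul_comm]
  have hρ : ∀ a : Plane, a • (ζ - ω) = (ζ - ω) <• a := fun a => by
    rw [smul_sub, smul_sub, hζ a, hωc a]
  have hρ1 : (ζ - ω) 1 = 0 := by
    rw [OneForm.sub_apply, sub_eq_zero]
    exact hω1.symm
  rw [← sub_add_cancel ζ ω]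
  refine Submodule.add_mem _ ?_ hω
  generalize ζ - ω = ρ at hρ hρ1
  have ha : ρ 0 ∈ Submodule.span ℂ ((fun p : ℕ × ℕ => x ^ p.1 * y ^ p.2) ''
      {p | (3 : ℤ) ∣ p.1 - 1 ∧ (3 : ℤ) ∣ p.2 - 1}) := by
    have hx := congrArg toTorus (congrFun (hρ x) 0)
    have hy := congrArg toTorus (congrFun (hρ y) 0)
    simp [OneForm.left_smul_apply, OneForm.right_smul_apply, commutation_x, commutation_y,
      hρ1] at hx hy
    refine mem_span_monomials fun m n hmn => ?_
    by_cases hm : (3 : ℤ) ∣ m - 1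
    · have := DFunLike.congr_fun (congrArg coeff hx) ((m : ℤ) + 1, (n : ℤ))
      simp [coeff_tx_mul, coeff_mul_tx, -mul_eq_mul_right_iff] at this
      refine coeff_eq_zero_of_smul_eq (k := n + 2) ?_ fun hn => hmn ⟨hm, by dsimp only; omega⟩
      rw [zpow_add₀ hq, zpow_natCast, mul_assoc]
      refine (congrArg _ this).trans ?_
      field_simp
    · have := DFunLike.congr_fun (congrArg coeff hy) ((m : ℤ), (n : ℤ) + 1)
      simp [coeff_ty_mul, coeff_mul_ty] at this
      refine coeff_eq_zero_of_smul_eq (k := 1 - m) ?_ fun hm' => hm (by omega)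
      rw [zpow_sub₀ hq, zpow_natCast, div_eq_mul_inv, mul_assoc, zpow_one]
      exact this
  let incl : Plane →ₗ[ℂ] OneForm :=
    { toFun := fun a => θ 0 <• a
      map_add' := fun a b => by rw [MulOpposite.op_add, add_smul]
      map_smul' := fun c a => by rw [MulOpposite.op_smul, smul_assoc]; rfl }
  have hρ' : ρ = incl (ρ 0) := by
    conv_lhs => rw [eq_sum_θ ρ, hρ1]
    simp [incl]
  rw [hρ']
  refine Submodule.span_mono ?_ (Submodule.map_span incl _ ▸ Submodule.mem_map_of_mem ha)
  rintro _ ⟨_, ⟨⟨m, n⟩, ⟨hm, hn⟩, rfl⟩, rfl⟩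
  obtain ⟨i, rfl⟩ : ∃ i, m = 3 * i + 1 := ⟨m / 3, by simp at hm; omega⟩
  obtain ⟨j, rfl⟩ : ∃ j, n = 3 * j + 1 := ⟨n / 3, by simp at hn; omega⟩
  refine ⟨0, i, j, ?_⟩
  simp only [incl, centralForm, LinearMap.coe_mk, AddHom.coe_mk, Matrix.cons_val_zero, ← mul_smul,
    ← MulOpposite.op_mul]
  rw [← monomial_mul_central 1 1, pow_one, pow_one]

/-- A monomial `z` in `x ^ 3`, `y ^ 3` has `d z = 0` and acts equally from both sides on forms and
tensors. Hence both connections and `σ` commute with multiplication by `z`. -/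
theorem sigmaCompatible_iff {nablaL nablaR : OneForm →ₗ[ℂ] TwoTensor}
    (hL : IsLeftConnection d nablaL) (hR : IsRightConnection d nablaR) :
    SigmaCompatible σ nablaL nablaR ↔
      ∀ k, nablaL (centralForm k) = σ (nablaR (centralForm k)) := by
  refine ⟨fun h k => h _ (centralForm_mem k), fun h ζ hζ => ?_⟩
  refine Submodule.span_induction (p := fun ζ _ => nablaL ζ = σ (nablaR ζ)) ?_ (by simp) ?_ ?_
    (bimoduleCentre_subset_span hζ)
  · rintro _ ⟨k, i, j, rfl⟩
    obtain ⟨hd, hz⟩ := monomial_mem_centralConstants i j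
    have ht (t : TwoTensor) : (x ^ (3 * i) * y ^ (3 * j)) • t = t <• (x ^ (3 * i) * y ^ (3 * j)) := by
      induction t using BalancedTensor.induction_on with
      | h0 => simp
      | ht m n =>
        rw [BalancedTensor.left_smul_tmul, hz, BalancedTensor.smul_tmul, hz,
          BalancedTensor.right_smul_tmul]
      | ha s t hs ht => rw [smul_add, smul_add, hs, ht]
    have h0 : BalancedTensor.tmul Plane (0 : OneForm) (centralForm k) = 0 := by
      simp [BalancedTensor.tmul]
    have h0' : BalancedTensor.tmul Plane (centralForm k) (0 : OneForm) = 0 := by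
      simp [BalancedTensor.tmul]
    rw [hR, hd, h0', add_zero, σ_right_smul, ← h k, ← ht, ← hz, hL, hd, h0, zero_add]
  · intro u v _ _ hu hv
    rw [map_add, map_add, map_add, hu, hv]
  · intro c u _ hu
    rw [map_smul, map_smul, map_smul, hu]

/-! ### Coefficients of two-tensors -/

/-- The coefficients `c j k` in `t = ∑ j, ∑ k, θθ j k <• c j k`. -/
noncomputable def tensorCoeff : TwoTensor →ₗ[ℂ] (Fin 2 → Fin 2 → Plane) :=
  rightLift fun j k => Pi.single j (Pi.single k 1)

theorem tensorCoeff_tmul (m n : OneForm) (j k : Fin 2) :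
    tensorCoeff (BalancedTensor.tmul Plane m n) j k = (m j • n) k := by
  rw [tensorCoeff, rightLift, BalancedTensor.lift_tmul]
  fin_cases j <;> fin_cases k <;> simp

theorem tensorCoeff_sum (c : Fin 2 → Fin 2 → Plane) :
    tensorCoeff (∑ j, ∑ k, θθ j k <• c j k) = c := by
  simp only [tensorCoeff, map_sum, rightLift_right_smul, rightLift_θθ]
  funext j k
  fin_cases j <;> fin_cases k <;> simp

theorem sum_tensorCoeff (t : TwoTensor) : ∑ j, ∑ k, θθ j k <• tensorCoeff t j k = t := by
  obtain ⟨c, rfl, -⟩ := existsUnique_coeff t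
  rw [tensorCoeff_sum]

theorem tensorCoeff_injective : Function.Injective tensorCoeff := fun s t h => by
  rw [← sum_tensorCoeff s, h, sum_tensorCoeff]

theorem tensorCoeff_right_smul (t : TwoTensor) (a : Plane) (j k : Fin 2) :
    tensorCoeff (t <• a) j k = tensorCoeff t j k * a := by
  rw [tensorCoeff, rightLift_right_smul]
  rfl

/-- The element `a` is moved past the first one-form, and each resulting matrix entry is then moved
past the second. -/
theorem tensorCoeff_left_smul (a : Plane) (t : TwoTensor) (j k : Fin 2) :
    tensorCoeff (a • t) j k =
      ∑ l, ∑ p, commutation (commutation a j l) k p * tensorCoeff t l p := by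
  induction t using BalancedTensor.induction_on with
  | h0 => simp
  | ht m n =>
    rw [BalancedTensor.left_smul_tmul]
    simp only [tensorCoeff_tmul, OneForm.left_smul_apply, Fin.sum_univ_two, map_add, map_mul,
      Matrix.add_apply, Matrix.mul_apply]
    simp only [mul_add, add_mul, mul_assoc]
    abel
  | ha s t hs ht =>
    simp only [smul_add, map_add, Pi.add_apply, hs, ht, mul_add, Finset.sum_add_distrib]

theorem tensorCoeff_σ (t : TwoTensor) :
    tensorCoeff (σ t) =
      ![![(q ^ 2)⁻¹ • tensorCoeff t 0 0, q⁻¹ • tensorCoeff t 1 0],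
        ![q⁻¹ • tensorCoeff t 0 1 - (1 - (q ^ 2)⁻¹) • tensorCoeff t 1 0,
          (q ^ 2)⁻¹ • tensorCoeff t 1 1]] := by
  have h : tensorCoeff (σ t) =
      ∑ j, ∑ k, fun l p => tensorCoeff (σ (θθ j k)) l p * tensorCoeff t j k := by
    conv_lhs => rw [← sum_tensorCoeff t]
    simp only [map_sum, σ_right_smul]
    congr! with j _ k _
    exact tensorCoeff_right_smul _ _ _ _
  have hθ (j k l p : Fin 2) : tensorCoeff (θθ j k) l p = if l = j ∧ p = k then 1 else 0 := by
    rw [θθ, tensorCoeff_tmul]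
    fin_cases j <;> fin_cases k <;> fin_cases l <;> fin_cases p <;>
      simp [θ_apply, OneForm.zero_apply]
  rw [h]
  funext l p
  fin_cases l <;> fin_cases p <;>
    simp [σ_ξξ, σ_ξη, σ_ηξ, σ_ηη, hθ, sub_eq_add_neg]

/-- The shift undoes the factor `x y` or `x² y²`, so that the unknown right symbols are evaluated
exactly at `(m, n)`. -/
theorem eq_iff_tensorCoeff_shift (s t : TwoTensor) (a b : ℤ) :
    s = t ↔ ∀ j k m n, coeff (toTorus (tensorCoeff s j k)) (m + a, n + b) =
      coeff (toTorus (tensorCoeff t j k)) (m + a, n + b) := by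
  refine ⟨fun h => by simp [h], fun h => tensorCoeff_injective ?_⟩
  funext j k
  refine toTorus_injective (torus_ext fun m n => ?_)
  simpa using h j k (m - a) (n - b)

/-! ### Right connections -/

/-- The right connection with prescribed values on `θ i`. -/
noncomputable def rightConnection (t : Fin 2 → TwoTensor) : OneForm →ₗ[ℂ] TwoTensor where
  toFun ω := ∑ i, (t i <• ω i + BalancedTensor.tmul Plane (θ i) (d (ω i)))
  map_add' ω ρ := by
    simp only [OneForm.add_apply, MulOpposite.op_add, add_smul, map_add,
      BalancedTensor.tmul_add, Finset.sum_add_distrib]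
    abel
  map_smul' c ω := by
    simp only [OneForm.complex_smul_apply, MulOpposite.op_smul, smul_assoc, map_smul,
      ← BalancedTensor.complex_smul_tmul_right, ← smul_add, Finset.smul_sum, RingHom.id_apply]

theorem isRightConnection_ext {nabla nabla' : OneForm →ₗ[ℂ] TwoTensor}
    (h : IsRightConnection d nabla) (h' : IsRightConnection d nabla')
    (hθ : ∀ i, nabla (θ i) = nabla' (θ i)) : nabla = nabla' := by
  ext ω
  rw [eq_sum_θ ω, map_add, map_add, h, h, h', h', hθ, hθ]

theorem rightConnection_isRightConnection (t : Fin 2 → TwoTensor) :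
    IsRightConnection d (rightConnection t) := by
  intro ω a
  simp only [rightConnection, LinearMap.coe_mk, AddHom.coe_mk, OneForm.right_smul_apply, d_mul,
    BalancedTensor.tmul_add, Finset.sum_add_distrib, MulOpposite.op_mul, mul_smul, smul_add,
    Finset.smul_sum, ← BalancedTensor.right_smul_tmul, ← BalancedTensor.smul_tmul]
  -- The terms `θ i ⊗ (ω i) da`, balanced to `(θ i) (ω i) ⊗ da`, add up to `ω ⊗ da`.
  conv_rhs => rw [eq_sum_θ ω, BalancedTensor.add_tmul]
  simp only [Fin.sum_univ_two, ← eq_sum_θ]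
  abel

theorem d_one : d 1 = 0 := by
  simp [d]

theorem rightConnection_θ (t : Fin 2 → TwoTensor) (i : Fin 2) :
    rightConnection t (θ i) = t i := by
  have h0 (ω : OneForm) : BalancedTensor.tmul Plane ω (0 : OneForm) = 0 := by
    simp [BalancedTensor.tmul]
  fin_cases i <;> simp [rightConnection, θ_apply, d_one, h0]

/-- The elements of the quantum torus that `RightSymbolFormulas` equates with the right
Christoffel symbols. -/
noncomputable def rightSymbol (Γ : Fin 2 → Fin 2 → Fin 2 → Plane) :
    Fin 2 → Fin 2 → Fin 2 → Torus :=
  ![![![q ^ 2 • (tx * ty * toTorus (Γ 0 0 0) * tyi * txi) +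
    (1 - q) • (ty ^ 2 * toTorus (Γ 0 0 1) * tyi * txi) +
    (q ^ 2 - 1) • (ty ^ 2 * toTorus (Γ 0 1 0) * tyi * txi),
      (q ^ 2 - 1) • (tx * ty * toTorus (Γ 0 0 1) * tyi * txi) +
    q • (tx * ty * toTorus (Γ 0 1 0) * tyi * txi) +
    (q - q ^ 2) • (ty ^ 2 * toTorus (Γ 0 1 1) * tyi * txi)],
    ![q • (tx * ty * toTorus (Γ 0 0 1) * tyi * txi) +
    (1 - q) • (ty ^ 2 * toTorus (Γ 0 1 1) * tyi * txi),
      q ^ 2 • (tx * ty * toTorus (Γ 0 1 1) * tyi * txi)]],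
  ![![tx * ty * toTorus (Γ 0 0 0) * txi ^ 2 -
    tx * toTorus (Γ 0 0 0) * ty * txi ^ 2 +
    (q - 1) • (ty * toTorus (Γ 0 0 1) * ty * txi ^ 2) +
    (q - q ^ 2) • (ty ^ 2 * toTorus (Γ 0 0 1) * txi ^ 2) +
    (1 - q ^ 2) • (ty * toTorus (Γ 0 1 0) * ty * txi ^ 2) +
    (1 - q) • (ty ^ 2 * toTorus (Γ 0 1 0) * txi ^ 2) +
    q ^ 2 • (tx ^ 2 * ty ^ 2 * toTorus (Γ 1 0 0) * tyi ^ 2 * txi ^ 2) +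
    (q - 1) • (tx * toTorus (Γ 1 0 1) * ty * txi ^ 2) +
    (1 - q ^ 2) • (tx * toTorus (Γ 1 1 0) * ty * txi ^ 2) +
    (3 : ℂ) • (ty * toTorus (Γ 1 1 1) * ty * txi ^ 2),
      (1 - q ^ 2) • (tx * toTorus (Γ 0 0 1) * ty * txi ^ 2) +
    (q ^ 2 - 1) • (ty ^ 2 * toTorus (Γ 0 1 1) * txi ^ 2) +
    (1 - q) • (tx * ty * toTorus (Γ 0 0 1) * txi ^ 2) +
    q ^ 2 • (tx * ty * toTorus (Γ 0 1 0) * txi ^ 2) -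
    q • (tx * toTorus (Γ 0 1 0) * ty * txi ^ 2) +
    (q - 1) • (ty * toTorus (Γ 0 1 1) * ty * txi ^ 2) +
    (q ^ 2 - 1) • (tx ^ 2 * ty ^ 2 * toTorus (Γ 1 0 1) * tyi ^ 2 * txi ^ 2) +
    q • (tx ^ 2 * ty ^ 2 * toTorus (Γ 1 1 0) * tyi ^ 2 * txi ^ 2) +
    (q ^ 2 - q) • (tx * toTorus (Γ 1 1 1) * ty * txi ^ 2)],
    ![q ^ 2 • (tx * ty * toTorus (Γ 0 0 1) * txi ^ 2) -
    q • (tx * toTorus (Γ 0 0 1) * ty * txi ^ 2) +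
    (1 - q ^ 2) • (ty * toTorus (Γ 0 1 1) * ty * txi ^ 2) +
    (q - q ^ 2) • (ty ^ 2 * toTorus (Γ 0 1 1) * txi ^ 2) +
    q • (tx ^ 2 * ty ^ 2 * toTorus (Γ 1 0 1) * tyi ^ 2 * txi ^ 2) +
    (q - 1) • (tx * toTorus (Γ 1 1 1) * ty * txi ^ 2),
      tx * ty * toTorus (Γ 0 1 1) * txi ^ 2 -
    q • (tx * toTorus (Γ 0 1 1) * ty * txi ^ 2) +
    q ^ 2 • (tx ^ 2 * ty ^ 2 * toTorus (Γ 1 1 1) * tyi ^ 2 * txi ^ 2)]]]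

/-! ### The compatibility equations on the two central generators. -/

theorem tensorCoeff_x_smul (t : TwoTensor) :
    tensorCoeff (x • t) =
      ![![q • (x * tensorCoeff t 0 0) + (q - q ^ 2) • (y * tensorCoeff t 0 1) +
            (1 - q) • (y * tensorCoeff t 1 0),
          x * tensorCoeff t 0 1 + (q - q ^ 2) • (y * tensorCoeff t 1 1)],
        ![x * tensorCoeff t 1 0 + (1 - q) • (y * tensorCoeff t 1 1),
          q ^ 2 • (x * tensorCoeff t 1 1)]] := by
  have h3 := q_pow_three
  have hr := q_relation
  funext j k
  rw [tensorCoeff_left_smul]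
  fin_cases j <;> fin_cases k <;>
    simp [Fin.sum_univ_two, commutation_x, commutation_y]
  all_goals
    match_scalars <;> grind

theorem tensorCoeff_y_smul (t : TwoTensor) :
    tensorCoeff (y • t) =
      ![![q ^ 2 • (y * tensorCoeff t 0 0), y * tensorCoeff t 0 1],
        ![y * tensorCoeff t 1 0, q • (y * tensorCoeff t 1 1)]] := by
  have h3 := q_pow_three
  funext j k
  rw [tensorCoeff_left_smul]
  fin_cases j <;> fin_cases k <;>
    simp [Fin.sum_univ_two, commutation_y]
  all_goals
    match_scalars
    grind

/-- These are the inhomogeneous Leibniz terms for the first generator. Their equality turns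
compatibility into an equation without differentials. -/
theorem differential_zero :
    BalancedTensor.tmul Plane (d (x * y)) (θ 0) =
      σ (BalancedTensor.tmul Plane (θ 0) (d (x * y))) := by
  have h3 := q_pow_three
  have hr := q_relation
  apply tensorCoeff_injective
  rw [tensorCoeff_σ]
  funext j k
  simp only [tensorCoeff_tmul, d_mul, d_x, d_y]
  fin_cases j <;> fin_cases k <;>
    simp [OneForm.left_smul_apply, OneForm.right_smul_apply, OneForm.add_apply, θ_apply,
      commutation_x, commutation_y, q_inv]
  all_goals
    match_scalars
    grind

theorem differential_one :
    BalancedTensor.tmul Plane (d (x ^ 2 * y ^ 2)) (θ 1) -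
        BalancedTensor.tmul Plane (d (x * y ^ 3)) (θ 0) =
      σ (BalancedTensor.tmul Plane (θ 1) (d (x ^ 2 * y ^ 2)) -
        q • BalancedTensor.tmul Plane (θ 0) (d (x * y ^ 3))) := by
  have h3 := q_pow_three
  have hr := q_relation
  have hinv := q_inv
  have h1 : d (x ^ 2 * y ^ 2) = θ 0 <• ((1 + q) • (x * y ^ 2)) - θ 1 <• (x ^ 2 * y) := by
    simp only [pow_two, d_mul, d_x, d_y]
    funext i
    fin_cases i <;> simp [OneForm.left_smul_apply, OneForm.right_smul_apply, OneForm.add_apply,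
      OneForm.sub_apply, θ_apply, commutation_x, commutation_y, add_mul, mul_assoc,
      y_mul_x_mul, q_inv, Matrix.mul_apply, -MulOpposite.op_mul, -MulOpposite.op_smul]
    all_goals
      match_scalars
      grind
  have h2 : d (x * y ^ 3) = θ 0 <• (y ^ 3) := by
    rw [d_mul, y_pow_three_mem.1, smul_zero, zero_add, d_x]
  rw [h1, h2]
  clear h1 h2
  apply tensorCoeff_injective
  rw [tensorCoeff_σ]
  funext j k
  simp only [tensorCoeff_tmul, map_sub, map_smul, Pi.sub_apply, Pi.smul_apply]
  fin_cases j <;> fin_cases k <;>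
    simp [OneForm.left_smul_apply, OneForm.right_smul_apply, OneForm.sub_apply, θ_apply,
      commutation_x, commutation_y, q_inv, pow_succ, mul_assoc, Matrix.mul_apply, y_mul_x_mul,
      -MulOpposite.op_mul, -MulOpposite.op_smul]
  all_goals
    match_scalars
    grind

variable {nablaL nablaR : OneForm →ₗ[ℂ] TwoTensor} {Γ Γt : Fin 2 → Fin 2 → Fin 2 → Plane}

theorem rightSymbolFormulas_iff :
    RightSymbolFormulas Γ Γt ↔ ∀ i j k, toTorus (Γt i j k) = rightSymbol Γ i j k := by
  constructor
  · rintro ⟨h1, h2, h3, h4, h5, h6, h7, h8⟩ i j k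
    fin_cases i <;> fin_cases j <;> fin_cases k <;> assumption
  · exact fun h => ⟨h 0 0 0, h 0 0 1, h 0 1 0, h 0 1 1, h 1 0 0, h 1 0 1, h 1 1 0, h 1 1 1⟩

theorem HasChristoffel.tensorCoeff_eq (h : HasChristoffel nablaL Γ) (i : Fin 2) :
    tensorCoeff (nablaL (θ i)) = Γ i := by
  rw [h, tensorCoeff_sum]

theorem compatible_zero_iff (hL : IsLeftConnection d nablaL) (hR : IsRightConnection d nablaR) :
    nablaL (centralForm 0) = σ (nablaR (centralForm 0)) ↔
      (x * y) • nablaL (θ 0) = σ (nablaR (θ 0) <• (x * y)) := by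
  conv in nablaL _ => rw [centralForm_zero_left, hL]
  conv in nablaR _ => rw [show centralForm 0 = θ 0 <• (x * y) from rfl, hR]
  rw [differential_zero, map_add, add_comm, add_left_inj]

theorem compatible_one_iff (hL : IsLeftConnection d nablaL) (hR : IsRightConnection d nablaR) :
    nablaL (centralForm 1) = σ (nablaR (centralForm 1)) ↔
      (x ^ 2 * y ^ 2) • nablaL (θ 1) - (x * y ^ 3) • nablaL (θ 0) =
        σ (nablaR (θ 1) <• (x ^ 2 * y ^ 2) - q • (nablaR (θ 0) <• (x * y ^ 3))) := by
  conv in nablaL (centralForm 1) => rw [centralForm_one_left, map_sub, hL, hL]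
  conv in nablaR (centralForm 1) =>
    rw [show centralForm 1 = θ 1 <• (x ^ 2 * y ^ 2) - q • (θ 0 <• (x * y ^ 3)) from rfl, map_sub,
      nablaR.map_smul, hR, hR]
  rw [add_sub_add_comm, differential_one, smul_add, add_sub_add_comm, map_add, add_comm,
    add_left_inj]

theorem q_zpow_pow_three (n : ℤ) : (q ^ n) ^ 3 = 1 := by
  rw [← zpow_natCast, ← zpow_mul, mul_comm, zpow_mul, zpow_natCast, q_pow_three, one_zpow]

theorem q_zpow_neg (n : ℤ) : q ^ (-n) = (q ^ n) ^ 2 := by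
  rw [zpow_neg]
  exact inv_eq_of_mul_eq_one_left (by rw [← pow_succ, q_zpow_pow_three])

/-- At each exponent the equation is a triangular linear system for the four right symbols, with
powers of `q` on the diagonal. The only off-diagonal entry comes from the second term of `σ (η ⊗
ξ)`. -/
theorem zero_symbols_iff {s t : TwoTensor} (hs : tensorCoeff s = Γ 0) (ht : tensorCoeff t = Γt 0) :
    (x * y) • s = σ (t <• (x * y)) ↔ ∀ j k, toTorus (Γt 0 j k) = rightSymbol Γ 0 j k := by
  have hq := q_ne_zero
  have h3 := q_pow_three
  have hr := q_relation
  have key (m n : ℤ) :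
      (∀ j k, coeff (toTorus (tensorCoeff ((x * y) • s) j k)) (m + 1, n + 1) =
        coeff (toTorus (tensorCoeff (σ (t <• (x * y))) j k)) (m + 1, n + 1)) ↔
      ∀ j k, coeff (toTorus (Γt 0 j k)) (m, n) = coeff (rightSymbol Γ 0 j k) (m, n) := by
    have hU := q_zpow_pow_three m
    have hV := q_zpow_pow_three n
    simp only [Fin.forall_fin_two, tensorCoeff_σ, tensorCoeff_right_smul, mul_smul,
      tensorCoeff_x_smul, tensorCoeff_y_smul, hs, ht, rightSymbol]
    simp [-mul_eq_mul_left_iff, -mul_eq_mul_right_iff]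
    simp only [pow_two, ← mul_assoc, coeff_mul_tx, coeff_mul_ty, coeff_mul_txi, coeff_mul_tyi]
    simp only [mul_assoc, coeff_tx_mul, coeff_ty_mul, sub_eq_add_neg, add_assoc, Int.reduceAdd,
      Int.reduceNeg, add_zero, neg_add, zpow_add₀ hq, q_zpow_neg, q_inv, mul_inv, zpow_one]
    generalize q ^ m = U at *
    generalize q ^ n = V at *
    generalize (coeff (toTorus (Γt 0 0 0))) (m, n) = g1
    generalize (coeff (toTorus (Γt 0 0 1))) (m, n) = g2
    generalize (coeff (toTorus (Γt 0 1 0))) (m, n) = g3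
    generalize (coeff (toTorus (Γt 0 1 1))) (m, n) = g4
    constructor
    · rintro ⟨⟨h1, h3'⟩, h2, h4⟩
      -- Each unknown is the side of its equation containing it, times an inverse scalar, by `V ^ 3
      -- = q ^ 3 = 1`; `g2` also needs a correction by `g3`.
      have e1 : g1 = V * q ^ 2 * (q ^ 2 * (q ^ 2 * (V ^ 2 * g1))) := by
        linear_combination (- g1) * hV - g1 * V ^ 3 * (q ^ 3 + 1) * h3
      have e3 : g3 = V * q * (q ^ 2 * (V ^ 2 * g3)) := by
        linear_combination (- g3) * hV - g3 * V ^ 3 * h3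
      have e2 : g2 = V * q * (q ^ 2 * (V ^ 2 * g2) +
          -((1 + -(q ^ 2 * q ^ 2)) * (V ^ 2 * g3))) + V * q * (1 - q) * (V ^ 2 * g3) := by
        linear_combination (- g2) * hV - g2 * V ^ 3 * h3 - V ^ 3 * q ^ 2 * g3 * h3
      have e4 : g4 = V * q ^ 2 * (q ^ 2 * (q ^ 2 * (V ^ 2 * g4))) := by
        linear_combination (- g4) * hV - g4 * V ^ 3 * (q ^ 3 + 1) * h3
      rw [← h1] at e1
      rw [← h4] at e4
      rw [← h3'] at e3
      rw [← h2, e3] at e2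
      clear h1 h2 h3' h4
      subst e1 e2 e3 e4
      clear * - hU hV h3 hr
      refine ⟨⟨?_, ?_⟩, ?_, ?_⟩ <;> grind
    · rintro ⟨⟨rfl, rfl⟩, rfl, rfl⟩
      clear * - hU hV h3 hr
      refine ⟨⟨?_, ?_⟩, ?_, ?_⟩ <;> grind
  rw [eq_iff_tensorCoeff_shift _ _ 1 1]
  exact ⟨fun h j k => torus_ext fun m n => (key m n).1 (fun j k => h j k m n) j k,
    fun h j k m n => (key m n).2 (fun j k => by rw [h]) j k⟩

theorem eq_iff_of_sub_eq {L R g P c : ℂ} (hc : c ≠ 0) (h : L - R = c * (P - g)) :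
    L = R ↔ g = P := by
  rw [← sub_eq_zero, h, mul_eq_zero, or_iff_right hc, sub_eq_zero, eq_comm]

/-- The second equation is triangular in the same way once the symbols with upper index 1 are
eliminated through `h0`. -/
theorem one_symbols_iff {s t : Fin 2 → TwoTensor} (hs : ∀ i, tensorCoeff (s i) = Γ i)
    (ht : ∀ i, tensorCoeff (t i) = Γt i)
    (h0 : ∀ j k, toTorus (Γt 0 j k) = rightSymbol Γ 0 j k) :
    (x ^ 2 * y ^ 2) • s 1 - (x * y ^ 3) • s 0 =
        σ (t 1 <• (x ^ 2 * y ^ 2) - q • (t 0 <• (x * y ^ 3))) ↔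
      ∀ j k, toTorus (Γt 1 j k) = rightSymbol Γ 1 j k := by
  have hq := q_ne_zero
  have h3 := q_pow_three
  have hr := q_relation
  have hq4 : (q ^ 2) ^ 2 = q := by linear_combination q * h3
  have key (m n : ℤ) :
      (∀ j k, coeff (toTorus (tensorCoeff ((x ^ 2 * y ^ 2) • s 1 - (x * y ^ 3) • s 0) j k))
          (m + 2, n + 2) =
        coeff (toTorus (tensorCoeff (σ (t 1 <• (x ^ 2 * y ^ 2) - q • (t 0 <• (x * y ^ 3)))) j k))
          (m + 2, n + 2)) ↔
      ∀ j k, coeff (toTorus (Γt 1 j k)) (m, n) = coeff (rightSymbol Γ 1 j k) (m, n) := by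
    have hU := q_zpow_pow_three m
    have hV := q_zpow_pow_three n
    -- Here `(m + 1, n - 1)` is `(m + 2, n + 2)` minus the exponents of the factor `x y³`.
    have k (j k : Fin 2) := DFunLike.congr_fun (congrArg coeff (h0 j k)) (m + 1, n + -1)
    have k00 := k 0 0
    have k01 := k 0 1
    have k10 := k 1 0
    have k11 := k 1 1
    clear k
    simp only [Fin.forall_fin_two, tensorCoeff_σ, tensorCoeff_right_smul, mul_smul, pow_succ,
      pow_zero, one_mul, map_sub, map_smul, Pi.sub_apply, Pi.smul_apply,
      tensorCoeff_x_smul, tensorCoeff_y_smul, hs, ht]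
    simp only [rightSymbol] at k00 k01 k10 k11 ⊢
    simp [-mul_eq_mul_left_iff, -mul_eq_mul_right_iff] at k00 k01 k10 k11 ⊢
    simp only [pow_two, ← mul_assoc, sub_mul, mul_add, mul_sub,
      mul_smul_comm, map_add, map_smul, coeff_mul_tx, coeff_mul_ty, coeff_mul_txi,
      coeff_mul_tyi, Finsupp.add_apply, Finsupp.smul_apply, smul_eq_mul]
      at k00 k01 k10 k11 ⊢
    simp only [mul_assoc, coeff_tx_mul, coeff_ty_mul, sub_eq_add_neg, add_assoc, Int.reduceAdd,
      Int.reduceNeg, add_zero, neg_add, zpow_add₀ hq, q_zpow_neg, q_inv, zpow_ofNat, hq4] at k00 k01 k10 k11 ⊢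
    rw [k00, k01, k10, k11]
    have hU0 : q ^ m ≠ 0 := zpow_ne_zero m hq
    have hV0 : q ^ n ≠ 0 := zpow_ne_zero n hq
    generalize q ^ m = U at *
    generalize q ^ n = V at *
    generalize (coeff (toTorus (Γt 1 0 0))) (m, n) = g1
    generalize (coeff (toTorus (Γt 1 0 1))) (m, n) = g2
    generalize (coeff (toTorus (Γt 1 1 0))) (m, n) = g3
    generalize (coeff (toTorus (Γt 1 1 1))) (m, n) = g4
    clear k00 k01 k10 k11 h0
    have hc (i : ℕ) : q ^ i * V ^ 4 ≠ 0 := mul_ne_zero (pow_ne_zero _ hq) (pow_ne_zero _ hV0)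
    constructor
    · rintro ⟨⟨h1, h3'⟩, h2, h4⟩
      -- The formula for `g3` has to be available before `g2` can be solved for.
      have assemble {A B C D : Prop} (hA : A) (hD : D) (hC : C) (hB : C → B) :
        (A ∧ B) ∧ C ∧ D := ⟨⟨hA, hB hC⟩, hC, hD⟩
      refine assemble ((eq_iff_of_sub_eq (hc 4) ?_).1 h1) ((eq_iff_of_sub_eq (hc 4) ?_).1 h4)
        ((eq_iff_of_sub_eq (hc 2) ?_).1 h3') fun e3 => ?_
      · clear * - hU hV hr
        grind
      · clear * - hU hV hr
        grind
      · clear * - hU hV hr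
        grind
      · rw [e3] at h2
        refine (eq_iff_of_sub_eq (hc 2) ?_).1 h2
        clear * - hU hV hr
        grind
    · rintro ⟨⟨rfl, rfl⟩, rfl, rfl⟩
      clear * - hU hV hr
      refine ⟨⟨?_, ?_⟩, ?_, ?_⟩ <;> grind
  rw [eq_iff_tensorCoeff_shift _ _ 2 2]
  exact ⟨fun h j k => torus_ext fun m n => (key m n).1 (fun j k => h j k m n) j k,
    fun h j k m n => (key m n).2 (fun j k => by rw [h]) j k⟩

theorem sigmaCompatible_iff_rightSymbolFormulas (hL : IsLeftConnection d nablaL)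
    (hR : IsRightConnection d nablaR) (hΓ : HasChristoffel nablaL Γ)
    (hΓt : HasChristoffel nablaR Γt) :
    SigmaCompatible σ nablaL nablaR ↔ RightSymbolFormulas Γ Γt := by
  rw [sigmaCompatible_iff hL hR, rightSymbolFormulas_iff, Fin.forall_fin_two, Fin.forall_fin_two,
    compatible_zero_iff hL hR, compatible_one_iff hL hR,
    zero_symbols_iff (hΓ.tensorCoeff_eq 0) (hΓt.tensorCoeff_eq 0)]
  exact and_congr_right fun h0 =>
    one_symbols_iff (s := fun i => nablaL (θ i)) (t := fun i => nablaR (θ i))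
      hΓ.tensorCoeff_eq hΓt.tensorCoeff_eq h0

/-! ### Divisibility -/

theorem coeff_tx_pow_mul (k : ℕ) (t : Torus) (m n : ℤ) :
    coeff (tx ^ k * t) (m, n) = coeff t (m - k, n) := by
  induction k generalizing m with
  | zero => simp
  | succ k ih =>
    rw [pow_succ', mul_assoc, coeff_tx_mul, ih, Nat.cast_add_one]
    congr 2
    ring

/-- Left multiplication by `x ^ k` shifts coefficients without weights, so the question is whether
`x ^ (-k) t` lies in the image of the plane. -/
theorem exists_eq_tx_pow_mul_iff (k : ℕ) (t : Torus) :
    (∃ a, t = tx ^ k * toTorus a) ↔ ∀ m n : ℤ, m < k ∨ n < 0 → coeff t (m, n) = 0 := by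
  constructor
  · rintro ⟨a, rfl⟩ m n h
    rw [coeff_tx_pow_mul]
    exact coeff_toTorus_of_neg _ (by omega)
  · intro h
    have hx : tx ^ k * txi ^ k = 1 := by
      have hc : Commute tx txi := by rw [Commute, SemiconjBy, torus_x_mul_inv, torus_inv_mul_x]
      rw [← hc.mul_pow, torus_x_mul_inv, one_pow]
    have ht : t = tx ^ k * (txi ^ k * t) := by rw [← mul_assoc, hx, one_mul]
    obtain ⟨a, ha⟩ := exists_toTorus_eq (t := txi ^ k * t) fun m n hmn => by
      have := h (m + k) n (by omega)
      rw [ht, coeff_tx_pow_mul] at this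
      simpa using this
    exact ⟨a, by rw [ha, ← ht]⟩

theorem exists_eq_x_pow_mul_iff (k : ℕ) (a : Plane) :
    (∃ b, a = x ^ k * b) ↔ ∀ m n : ℤ, m < k ∨ n < 0 → coeff (toTorus a) (m, n) = 0 := by
  rw [← exists_eq_tx_pow_mul_iff]
  refine exists_congr fun b => ?_
  rw [← toTorus_injective.eq_iff, map_mul, map_pow, toTorus_x]

/-- The divisibility conditions, in terms of coefficients. -/
theorem divisibilityConditions_iff_coeff :
    DivisibilityConditions Γ ↔ ∀ n : ℤ,
      coeff (toTorus (Γ 0 0 1)) (0, n) = 0 ∧ coeff (toTorus (Γ 0 1 0)) (0, n) = 0 ∧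
      coeff (toTorus (Γ 0 1 1)) (0, n) = 0 ∧ coeff (toTorus (Γ 0 1 1)) (1, n) = 0 ∧
      coeff (toTorus (Γ 1 1 1)) (0, n) = 0 ∧
      (q - 1) * coeff (toTorus (Γ 1 0 1)) (0, n) + (1 - q ^ 2) * coeff (toTorus (Γ 1 1 0)) (0, n) +
        3 * q ^ 2 * coeff (toTorus (Γ 1 1 1)) (1, n - 1) = 0 := by
  have hx (t : Torus) : (∃ a, t = tx * toTorus a) ↔
      ∀ m n : ℤ, m < 1 ∨ n < 0 → coeff t (m, n) = 0 := by
    simpa using exists_eq_tx_pow_mul_iff 1 t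
  have hx' (a : Plane) : (∃ b, a = x * b) ↔
      ∀ m n : ℤ, m < 1 ∨ n < 0 → coeff (toTorus a) (m, n) = 0 := by
    simpa using exists_eq_x_pow_mul_iff 1 a
  have hneg (a : Plane) (m n : ℤ) (h : m < 0 ∨ n < 0) := coeff_toTorus_of_neg a h
  have hcomb (m n : ℤ) : coeff ((q - 1) • toTorus (Γ 1 0 1) + (1 - q ^ 2) • toTorus (Γ 1 1 0) +
      (3 * q ^ 2) • (ty * txi * toTorus (Γ 1 1 1))) (m, n) =
      (q - 1) * coeff (toTorus (Γ 1 0 1)) (m, n) + (1 - q ^ 2) * coeff (toTorus (Γ 1 1 0)) (m, n) +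
        3 * q ^ 2 * (q ^ (-m) * coeff (toTorus (Γ 1 1 1)) (m + 1, n - 1)) := by
    simp [mul_assoc, coeff_ty_mul, coeff_txi_mul]
  constructor
  · rintro ⟨h1, h2, h3, h4, h5⟩ n
    rw [hx'] at h1 h2 h4
    rw [exists_eq_x_pow_mul_iff] at h3
    rw [hx] at h5
    refine ⟨h1 _ _ (by simp), h2 _ _ (by simp), h3 _ _ (by simp), h3 _ _ (by simp),
      h4 _ _ (by simp), ?_⟩
    have := h5 0 n (by simp)
    rw [hcomb] at this
    simpa using this
  · intro h
    have zero_of (a : Plane) (h0 : ∀ n : ℤ, coeff (toTorus a) (0, n) = 0) (m n : ℤ)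
        (hmn : m < 1 ∨ n < 0) : coeff (toTorus a) (m, n) = 0 := by
      by_cases hm : m = 0
      · rw [hm, h0]
      · exact hneg _ _ _ (by omega)
    refine ⟨(hx' _).2 (zero_of _ fun n => (h n).1), (hx' _).2 (zero_of _ fun n => (h n).2.1),
      (exists_eq_x_pow_mul_iff 2 _).2 fun m n hmn => ?_,
      (hx' _).2 (zero_of _ fun n => (h n).2.2.2.2.1), (hx _).2 fun m n hmn => ?_⟩
    · by_cases hm : m = 1
      · rw [hm, (h n).2.2.2.1]
      · exact zero_of _ (fun n => (h n).2.2.1) _ _ (by push_cast at hmn; omega)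
    -- Only exponent `0` of `x` gives a new condition. At exponent `-1` the term with `y x⁻¹` sees
    -- the constant-in-`x` part of `Γ 1 1 1`, which vanishes by the fourth condition.
    · rw [hcomb]
      by_cases hm : m = 0
      · subst hm
        simpa using (h n).2.2.2.2.2
      · rw [hneg (Γ 1 0 1) m n (by omega), hneg (Γ 1 1 0) m n (by omega),
          zero_of (Γ 1 1 1) (fun n => (h n).2.2.2.2.1) _ _ (by omega)]
        simp

theorem forall_exists_rightSymbol_iff :
    (∀ i j k, ∃ a, toTorus a = rightSymbol Γ i j k) ↔
      ∀ i j k (m n : ℤ), m < 0 ∨ n < 0 → coeff (rightSymbol Γ i j k) (m, n) = 0 := by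
  refine forall₃_congr fun i j k => ⟨?_, exists_toTorus_eq⟩
  rintro ⟨a, ha⟩ m n h
  rw [← ha]
  exact coeff_toTorus_of_neg a h

/-- The terms of the formulas shift exponents by `(0, 0)`, `(-1, 1)` or `(-2, 2)`. Hence bad
coefficients can occur only at `x`-exponents `-1` and `-2`, where they involve just the coefficients
of `Γ` at `x ^ 0` and `x ^ 1`. -/
theorem divisibilityConditions_iff_exists :
    DivisibilityConditions Γ ↔ ∀ i j k, ∃ a, toTorus a = rightSymbol Γ i j k := by
  have hq := q_ne_zero
  have hr := q_relation
  have h3 := q_pow_three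
  have hneg (a : Plane) (m n : ℤ) (h : m < 0 ∨ n < 0) := coeff_toTorus_of_neg a h
  rw [divisibilityConditions_iff_coeff, forall_exists_rightSymbol_iff]
  constructor
  · intro h i j k m n hmn
    have z1 (n : ℤ) := (h n).1
    have z2 (n : ℤ) := (h n).2.1
    have z3 (n : ℤ) := (h n).2.2.1
    have z4 (n : ℤ) := (h n).2.2.2.1
    have z5 (n : ℤ) := (h n).2.2.2.2.1
    have z6 := (h (n + -1)).2.2.2.2.2
    rw [show n + -1 - 1 = n + -2 by ring] at z6
    have hq2 : (q ^ 2)⁻¹ = q := inv_eq_of_mul_eq_one_left (by linear_combination h3)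
    have hcases : (n < 0 ∨ m ≤ -3) ∨ m = -2 ∨ m = -1 := by omega
    clear h
    fin_cases i <;> fin_cases j <;> fin_cases k <;> simp [rightSymbol]
    all_goals
      simp only [pow_two, ← mul_assoc, coeff_mul_ty, coeff_mul_txi, coeff_mul_tyi]
      simp only [mul_assoc, coeff_tx_mul, coeff_ty_mul, sub_eq_add_neg, add_assoc, Int.reduceAdd,
        Int.reduceNeg, add_zero, neg_add, zpow_add₀ hq]
      rcases hcases with hmn | rfl | rfl
      · simp (disch := omega) [hneg]
      · simp (disch := omega) [hneg, z1, z2, z3, z5]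
      · simp (disch := omega) [hneg, z1, z2, z3, z4, z5]
        try -- only the coefficients of `rightSymbol Γ 1 0 0` are left
          simp only [hq2]
          generalize coeff (toTorus (Γ 0 0 1)) (1, n + -2) = r1
          generalize coeff (toTorus (Γ 0 1 0)) (1, n + -2) = r2
          generalize q ^ n = V
          linear_combination V ^ 2 * z6 + V ^ 2 * ((q ^ 2 - q ^ 3) * r1 - q ^ 2 * r2) * h3
  · intro H
    -- A coefficient at a fixed exponent couples `(0, n)` with `(1, n - 1)` because of the two
    -- shifts `(-1, 1)` and `(-2, 2)`, so the condition on `Γ 0 1 1` is reindexed.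
    suffices main : ∀ n : ℤ,
        coeff (toTorus (Γ 0 0 1)) (0, n) = 0 ∧ coeff (toTorus (Γ 0 1 0)) (0, n) = 0 ∧
        coeff (toTorus (Γ 0 1 1)) (0, n) = 0 ∧ coeff (toTorus (Γ 0 1 1)) (1, n - 1) = 0 ∧
        coeff (toTorus (Γ 1 1 1)) (0, n) = 0 ∧
        (q - 1) * coeff (toTorus (Γ 1 0 1)) (0, n) +
          (1 - q ^ 2) * coeff (toTorus (Γ 1 1 0)) (0, n) +
            3 * q ^ 2 * coeff (toTorus (Γ 1 1 1)) (1, n - 1) = 0 by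
      intro n
      refine ⟨(main n).1, (main n).2.1, (main n).2.2.1, ?_, (main n).2.2.2.2⟩
      simpa using (main (n + 1)).2.2.2.1
    intro n
    have e1 := H 0 0 0 (-1) (n + 1) (by simp)
    have e2 := H 1 0 1 (-1) (n + 1) (by simp)
    have e3 := H 1 1 0 (-1) (n + 1) (by simp)
    have e4 := H 1 0 0 (-2) (n + 2) (by simp)
    have e5 := H 0 0 1 (-1) (n + 1) (by simp)
    have e6 := H 1 0 0 (-1) (n + 1) (by simp)
    clear H
    simp [rightSymbol] at e1 e2 e3 e4 e5 e6
    simp only [pow_two, ← mul_assoc, coeff_mul_ty, coeff_mul_txi, coeff_mul_tyi]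
      at e1 e2 e3 e4 e5 e6
    simp only [mul_assoc, coeff_tx_mul, coeff_ty_mul, sub_eq_add_neg, add_assoc, Int.reduceAdd,
        Int.reduceNeg, add_zero, zpow_add₀ hq, zpow_neg, neg_neg] at e1 e2 e3 e4 e5 e6
    simp (disch := omega) [hneg] at e1 e2 e3 e4 e5 e6
    clear hneg
    have hV0 : q ^ n ≠ 0 := zpow_ne_zero n hq
    simp only [sub_eq_add_neg, q_inv] at *
    generalize q ^ n = V at *
    generalize coeff (toTorus (Γ 0 0 1)) (0, n) = a at *
    generalize coeff (toTorus (Γ 0 1 0)) (0, n) = b at *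
    generalize coeff (toTorus (Γ 0 1 1)) (1, n + -1) = k at *
    generalize coeff (toTorus (Γ 1 1 1)) (0, n) = c at *
    have cancel (i j : ℕ) {z : ℂ} (hz : V ^ i * q ^ j * z = 0) : z = 0 :=
      (mul_eq_zero.1 hz).resolve_left (mul_ne_zero (pow_ne_zero _ hV0) (pow_ne_zero _ hq))
    have f1 : (1 - q) * a + (q ^ 2 - 1) * b = 0 := cancel 1 1 (by linear_combination e1)
    have f2 : 3 * q * a + (1 - q ^ 2) * b + 3 * q * k + (1 - q ^ 2) * c = 0 :=
      cancel 2 1 (by grind)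
    have f3 : (1 - q ^ 2) * a + 3 * k + (q ^ 2 - q) * c = 0 := cancel 2 1 (by grind)
    have f4 : q * a + b + c = 0 := cancel 2 1 (by grind)
    -- `f1` gives `b`, and then `f4` gives `c = 0`. Subtracting `q` times `f3` from `f2` leaves a
    -- multiple of `(1 + 2 * q ^ 2) * a`, whose scalar is nonzero, and finally `f3` gives `k = 0`.
    have hb : b = - q * a := by grind
    have hc : c = 0 := by grind
    have ha : a = 0 := by grind
    have hk : k = 0 := by grind
    have hq1 : q + -(q * q) ≠ 0 := by grind
    have f6 : (q - 1) * coeff (toTorus (Γ 1 0 1)) (0, n) +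
        (1 - q ^ 2) * coeff (toTorus (Γ 1 1 0)) (0, n) +
        3 * q ^ 2 * coeff (toTorus (Γ 1 1 1)) (1, n + -1) = 0 := by
      generalize coeff (toTorus (Γ 0 0 1)) (1, n + -1) = r1 at *
      generalize coeff (toTorus (Γ 0 1 0)) (1, n + -1) = r2 at *
      generalize coeff (toTorus (Γ 1 0 1)) (0, n) = r3 at *
      generalize coeff (toTorus (Γ 1 1 0)) (0, n) = r4 at *
      generalize coeff (toTorus (Γ 1 1 1)) (1, n + -1) = r5 at *
      clear * - cancel e6 hr
      exact cancel 2 2 (by grind)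
    exact ⟨ha, by rw [hb, ha, mul_zero], by simpa [hq1, hV0, hq] using e5, hk, hc,
      by simpa only [sub_eq_add_neg] using f6⟩

/-! ### Existence and uniqueness of the compatible right connection -/

theorem exists_hasChristoffel (nabla : OneForm →ₗ[ℂ] TwoTensor) : ∃ Γ, HasChristoffel nabla Γ :=
  ⟨fun i => tensorCoeff (nabla (θ i)), fun _ => (sum_tensorCoeff _).symm⟩

theorem exists_compatible_iff (hL : IsLeftConnection d nablaL) (hΓ : HasChristoffel nablaL Γ) :
    (∃ nablaR : OneForm →ₗ[ℂ] TwoTensor,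
        IsRightConnection d nablaR ∧ SigmaCompatible σ nablaL nablaR) ↔
      DivisibilityConditions Γ := by
  rw [divisibilityConditions_iff_exists]
  constructor
  · rintro ⟨nablaR, hR, hσ⟩ i j k
    obtain ⟨Γt, hΓt⟩ := exists_hasChristoffel nablaR
    rw [sigmaCompatible_iff_rightSymbolFormulas hL hR hΓ hΓt, rightSymbolFormulas_iff] at hσ
    exact ⟨_, hσ i j k⟩
  · intro h
    choose Γt hΓt using h
    have hR := rightConnection_isRightConnection fun i => ∑ j, ∑ k, θθ j k <• Γt i j k
    refine ⟨_, hR, (sigmaCompatible_iff_rightSymbolFormulas hL hR hΓ (Γt := Γt) fun _ => ?_).2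
      (rightSymbolFormulas_iff.2 hΓt)⟩
    rw [rightConnection_θ]

/-- Both sets of right symbols have the same image in the torus, hence agree in the plane, and they
determine the connection. -/
theorem compatible_unique {nablaR' : OneForm →ₗ[ℂ] TwoTensor} (hL : IsLeftConnection d nablaL)
    (hR : IsRightConnection d nablaR) (hR' : IsRightConnection d nablaR')
    (hσ : SigmaCompatible σ nablaL nablaR) (hσ' : SigmaCompatible σ nablaL nablaR') :
    nablaR = nablaR' := by
  obtain ⟨Γ, hΓ⟩ := exists_hasChristoffel nablaL
  obtain ⟨Γt, hΓt⟩ := exists_hasChristoffel nablaR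
  obtain ⟨Γt', hΓt'⟩ := exists_hasChristoffel nablaR'
  rw [sigmaCompatible_iff_rightSymbolFormulas hL hR hΓ hΓt, rightSymbolFormulas_iff] at hσ
  rw [sigmaCompatible_iff_rightSymbolFormulas hL hR' hΓ hΓt', rightSymbolFormulas_iff] at hσ'
  refine isRightConnection_ext hR hR' fun i => ?_
  rw [hΓt, hΓt']
  refine Finset.sum_congr rfl fun j _ => Finset.sum_congr rfl fun k _ => ?_
  rw [toTorus_injective ((hσ i j k).trans (hσ' i j k).symm)]

end QuantumPlane

/-- Let `nablaL` be a left connection on the bimodule of one-forms of the quantum plane at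
`q = e^{2πi/3}`, with Christoffel symbols `Γ`. -/
theorem proposition4p3
    (nablaL : OneForm →ₗ[ℂ] TwoTensor) (hL : IsLeftConnection d nablaL)
    (Γ : Fin 2 → Fin 2 → Fin 2 → Plane) (hΓ : HasChristoffel nablaL Γ) :
    ((∃ nablaR : OneForm →ₗ[ℂ] TwoTensor,
        IsRightConnection d nablaR ∧ SigmaCompatible σ nablaL nablaR) ↔
      DivisibilityConditions Γ) ∧
    (DivisibilityConditions Γ →
      ∃! nablaR : OneForm →ₗ[ℂ] TwoTensor,
        IsRightConnection d nablaR ∧ SigmaCompatible σ nablaL nablaR) ∧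
    (∀ (nablaR : OneForm →ₗ[ℂ] TwoTensor) (Γt : Fin 2 → Fin 2 → Fin 2 → Plane),
      IsRightConnection d nablaR → HasChristoffel nablaR Γt →
        (SigmaCompatible σ nablaL nablaR ↔ RightSymbolFormulas Γ Γt)) := by
  refine ⟨exists_compatible_iff hL hΓ, fun h => ?_, fun nablaR Γt hR hΓt =>
    sigmaCompatible_iff_rightSymbolFormulas hL hR hΓ hΓt⟩
  obtain ⟨nablaR, hR, hσ⟩ := (exists_compatible_iff hL hΓ).2 h
  exact ⟨nablaR, ⟨hR, hσ⟩, fun _ h' => compatible_unique hL h'.1 hR h'.2 hσ⟩
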